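/- \textbf{Theorem (type $D_\ell$, $\ell$ even).} Let $\ell\ge 4$ be even and let $\Phi$ be a root system of type $D_\ell$ with simple roots $\alpha_1,\dots,\alpha_\ell$, numbered so that $\alpha_1,\dots,\alpha_{\ell-2}$ form a chain in the Dynkin diagram and $\alpha_{\ell-2}$ is joined to both $\alpha_{\ell-1}$ and $\alpha_\ell$. Let $W$ be the Weyl group of $\Phi$ and let $Z=\{x : (\beta,x)\in\mathbb Z \text{ for all } \beta\in\Phi\}$ be the coweight lattice. For a positive integer $q$ let $\pi_q:Z\to Z/qZ$ be the projection, let $$M(\Phi;q)=\{\pi_q(x) : x\in Z,\ (\beta,x)\not\equiv 0 \pmod q \text{ for all } \beta\in\Phi\}\subseteq Z/qZ,$$ on which $W$ acts by $w\cdot\pi_q(x)=\pi_q(w(x))$, and let $\chi_{\Phi,q}$ be the permutation character of this action, i.e. $\chi_{\Phi,q}(w)=\#\{y\in M(\Phi;q) : w\cdot y=y\}$. For $j\in\{1,\ell-1,\ell\}$ let $\omega_j=w_jw_0\in W$, where $w_0$ is the longest element of $W$ and $w_j$ is the longest element of the subgroup generated by the simple reflections $s_{\alpha_i}$ with $i\ne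 j$. Then for every positive integer $q$ the following hold. (1) For the identity element, $$\chi_{\Phi,q}(1)=\begin{cases}(q-1)(q-3)\cdots(q-(2\ell-3))\,(q-(\ell-1)) & \text{if } q \text{ is odd},\\ (q-2)(q-4)\cdots(q-2(\ell-2))\left(q^2-2(\ell-1)q+\frac{\ell(\ell-1)}{2}\right) & \text{if } q \text{ is even}.\end{cases}$$ (2) For $\omega_1$, $$\chi_{\Phi,q}(\omega_1)=\begin{cases}0 & \text{if } q \text{ is odd},\\ (q-2)(q-4)\cdots(q-2(\ell-2)) & \text{if } q \text{ is even}.\end{cases}$$ (3) For $\omega\in\{\omega_{\ell-1},\omega_\ell\}$, $$\chi_{\Phi,q}(\omega)=\begin{cases}0 & \text{if } \gcd(4,q)=1,\\ (q-2)(q-6)\cdots(q-2(\ell-3))\left(q-\left(\frac{3\ell}{2}-2\right)\right) & \text{if } \gcd(4,q)=2,\\ (q-4)(q-8)\cdots(q-2(\ell-2))\left(q-\frac{\ell}{2}\right) & \text{if } \gcd(4,q)=4.\end{cases}$$ In (1) and (2) consecutive linear factors in the products written with dots differ by $2$, in (3) they differ by $4$. -/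

import Mathlib

noncomputable section

namespace WeylChar

/-! ### Word length and longest elements -/

section Longest

variable {G : Type*} [Group G]

/-- Length of `w` with respect to a set `S` of generators: the least `n` such that `w` is a product
of `n` elements of `S`. (Used only for `w` in the subgroup generated by a set `S` of involutions,
where such words exist.) -/
def wordLength (S : Set G) (w : G) : ℕ :=
  sInf {n | ∃ L : List G, (∀ s ∈ L, s ∈ S) ∧ L.length = n ∧ L.prod = w}

/-- `w` is an element of maximal length in the subgroup generated by `S`. -/
def IsLongest (S : Set G) (w : G) : Prop :=
  w ∈ Subgroup.closure S ∧ ∀ v ∈ Subgroup.closure S, wordLength S v ≤ wordLength S w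

theorem exists_isLongest [Finite G] (S : Set G) : ∃ w, IsLongest S w :=
  Set.exists_max_image (Subgroup.closure S : Set G) (wordLength S) (Set.toFinite _)
    ⟨1, one_mem _⟩

/-- The longest element of the (finite) group generated by `S`, with respect to `S`. -/
def longestElement [Finite G] (S : Set G) : G := Classical.choose (exists_isLongest S)

end Longest

/-- The permutation character of `G` on a finite `G`-set `X`: the number of fixed points. -/
def permCharacter (G X : Type*) [Group G] [MulAction G X] (g : G) : ℕ :=
  Nat.card (MulAction.fixedBy X g)

variable {ι M N : Type*} [AddCommGroup M] [Module ℝ M] [AddCommGroup N] [Module ℝ N]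

instance weylGroup_finite [Finite ι] (P : RootPairing ι ℝ M N) [P.IsRootSystem] :
    Finite P.weylGroup := by
  refine Finite.of_injective P.weylGroupToPerm fun g h hgh => ?_
  apply Subtype.ext
  apply RootPairing.Equiv.weightHom_injective P
  refine LinearEquiv.toLinearMap_injective
    (LinearMap.ext_on_range (v := P.root) RootPairing.IsRootSystem.span_root_eq_top fun i => ?_)
  have h1 := P.weylGroup_apply_root g i
  have h2 := P.weylGroup_apply_root h i
  rw [hgh] at h1
  exact h1.trans h2.symm

/-! ### Coweight lattice, the complement modulo `q`, and the action of the Weyl group -/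

/-- The coweight lattice `Z`: all `x` on which every root takes an integer value. -/
def coweightLattice (P : RootPairing ι ℝ M N) : AddSubgroup N where
  carrier := {x | ∀ i, ∃ n : ℤ, P.root' i x = n}
  zero_mem' := fun _ => ⟨0, by simp⟩
  add_mem' := fun {x y} hx hy i => by
    obtain ⟨m, hm⟩ := hx i
    obtain ⟨n, hn⟩ := hy i
    exact ⟨m + n, by rw [map_add, hm, hn]; push_cast; rfl⟩
  neg_mem' := fun {x} hx i => by
    obtain ⟨m, hm⟩ := hx i
    exact ⟨-m, by rw [map_neg, hm]; push_cast; rfl⟩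

/-- The (left) action of a Weyl group element `w` on the space `N` containing the coweight lattice.
It is contragredient to the action on `M`, see `pairing_coweightAct`; reflections in roots act by the
corresponding coreflections. -/
def coweightAct (P : RootPairing ι ℝ M N) (w : P.weylGroup) : N ≃ₗ[ℝ] N :=
  RootPairing.Equiv.coweightEquiv P P (w : P.Aut)⁻¹

theorem coweightAct_one (P : RootPairing ι ℝ M N) (x : N) : coweightAct P 1 x = x := by
  simp [coweightAct]

theorem coweightAct_mul (P : RootPairing ι ℝ M N) (v w : P.weylGroup) (x : N) :
    coweightAct P (v * w) x = coweightAct P v (coweightAct P w x) := by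
  simp [coweightAct]

theorem coweightAct_ofIdx (P : RootPairing ι ℝ M N) (i : ι) (x : N) :
    coweightAct P (RootPairing.weylGroup.ofIdx P i) x = P.coreflection i x := by
  simp [coweightAct, RootPairing.weylGroup.ofIdx]

theorem pairing_coweightAct (P : RootPairing ι ℝ M N) (w : P.weylGroup) (m : M) (x : N) :
    P.toLinearMap m (coweightAct P w x) = P.toLinearMap (w⁻¹ • m) x :=
  (LinearMap.congr_fun
    (RootPairing.Hom.weight_coweight_transpose_apply P P x ((w : P.Aut)⁻¹).toHom) m).symm

theorem root'_coweightAct (P : RootPairing ι ℝ M N) (w : P.weylGroup) (i : ι) (x : N) :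
    P.root' i (coweightAct P w x) = P.root' (P.weylGroupToPerm w⁻¹ i) x := by
  have h := pairing_coweightAct P w (P.root i) x
  rw [P.weylGroup_apply_root] at h
  exact h

theorem coweightAct_mem (P : RootPairing ι ℝ M N) (w : P.weylGroup) {x : N}
    (hx : x ∈ coweightLattice P) : coweightAct P w x ∈ coweightLattice P := fun i => by
  rw [root'_coweightAct]
  exact hx _

/-- The Weyl group acts on the coweight lattice. -/
instance latticeAction (P : RootPairing ι ℝ M N) :
    DistribMulAction P.weylGroup (coweightLattice P) where
  smul w x := ⟨coweightAct P w x, coweightAct_mem P w x.2⟩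
  one_smul x := Subtype.ext (coweightAct_one P x)
  mul_smul v w x := Subtype.ext (coweightAct_mul P v w x)
  smul_zero w := Subtype.ext (map_zero (coweightAct P w))
  smul_add w x y := Subtype.ext (map_add (coweightAct P w) (x : N) (y : N))

/-- The subgroup `qZ` of the coweight lattice `Z`. -/
def multiples (P : RootPairing ι ℝ M N) (q : ℕ) : AddSubgroup (coweightLattice P) :=
  (nsmulAddMonoidHom (α := coweightLattice P) q).range

/-- The quotient `Z / qZ`. -/
abbrev LatticeMod (P : RootPairing ι ℝ M N) (q : ℕ) : Type _ :=
  coweightLattice P ⧸ multiples P q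

/-- The endomorphism of `Z / qZ` induced by a Weyl group element. -/
def modAct (P : RootPairing ι ℝ M N) (q : ℕ) (w : P.weylGroup) :
    LatticeMod P q →+ LatticeMod P q :=
  QuotientAddGroup.map (multiples P q) (multiples P q)
    (DistribSMul.toAddMonoidHom (coweightLattice P) w) (by
      rintro _ ⟨x, rfl⟩
      exact ⟨w • x, ((DistribSMul.toAddMonoidHom (coweightLattice P) w).map_nsmul q x).symm⟩)

/-- The complement `M(Φ; q)`: classes `π_q(x)` in `Z / qZ` of those `x` for which no root takes a
value divisible by `q`. (Since `Φ = Φ⁺ ∪ -Φ⁺`, it is the same to use positive roots only.) -/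
def complement (P : RootPairing ι ℝ M N) (q : ℕ) : Set (LatticeMod P q) :=
  {y | ∃ x : coweightLattice P, (x : LatticeMod P q) = y ∧
    ∀ i, ¬ ∃ k : ℤ, P.root' i (x : N) = (q : ℝ) * k}

theorem modAct_mem (P : RootPairing ι ℝ M N) (q : ℕ) (w : P.weylGroup) {y : LatticeMod P q}
    (hy : y ∈ complement P q) : modAct P q w y ∈ complement P q := by
  obtain ⟨x, rfl, hx⟩ := hy
  refine ⟨w • x, rfl, fun i => ?_⟩
  change ¬ ∃ k : ℤ, P.root' i (coweightAct P w (x : N)) = (q : ℝ) * k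
  rw [root'_coweightAct]
  exact hx _

/-- The Weyl group acts on `M(Φ; q)` by `w · π_q(x) = π_q(w x)`. -/
instance complementAction (P : RootPairing ι ℝ M N) (q : ℕ) :
    MulAction P.weylGroup (complement P q) where
  smul w y := ⟨modAct P q w y, modAct_mem P q w y.2⟩
  one_smul y := by
    obtain ⟨y, hy⟩ := y
    refine Subtype.ext ?_
    induction y using QuotientAddGroup.induction_on with
    | H x => exact congrArg (QuotientAddGroup.mk (s := multiples P q)) (one_smul P.weylGroup x)
  mul_smul v w y := by
    obtain ⟨y, hy⟩ := y
    refine Subtype.ext ?_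
    induction y using QuotientAddGroup.induction_on with
    | H x => exact congrArg (QuotientAddGroup.mk (s := multiples P q)) (mul_smul v w x)

/-- The equivariant characteristic quasi-polynomial `χ_{Φ,q}`: the permutation character of the
Weyl group on `M(Φ; q)`. -/
def equivChar (P : RootPairing ι ℝ M N) (q : ℕ) (w : P.weylGroup) : ℕ :=
  permCharacter P.weylGroup (complement P q) w

/-! ### The elements `ω_j` and root systems of type `D_ℓ` -/

/-- The simple reflections in the simple roots indexed by `K`. -/
def simpleReflections (P : RootPairing ι ℝ M N) (K : Set ι) : Set P.weylGroup :=
  RootPairing.weylGroup.ofIdx P '' K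

/-- For a base `b` and a simple root with index `j`: the element `ω_j = w_j w_0`, where `w_0` is the
longest element of the Weyl group and `w_j` is the longest element of the parabolic subgroup
generated by the simple reflections other than `s_j`. -/
def omega [Finite ι] {P : RootPairing ι ℝ M N} [P.IsRootSystem] (b : P.Base) (j : ι) :
    P.weylGroup :=
  longestElement (simpleReflections P ((b.support : Set ι) \ {j})) *
    longestElement (simpleReflections P (b.support : Set ι))

/-- `α` lists the simple roots of the base `b` as `α_1, …, α_ℓ` (here `α 0, …, α (ℓ - 1)`) such that
the Cartan matrix is that of type `D_ℓ`: `α_1, …, α_{ℓ-2}` is a chain whose end `α_{ℓ-2}` is joined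
to both `α_{ℓ-1}` and `α_ℓ`. -/
def IsLabellingD {P : RootPairing ι ℝ M N} [P.IsCrystallographic] (b : P.Base) (ℓ : ℕ)
    (α : Fin ℓ ≃ b.support) : Prop :=
  ∀ i j, b.cartanMatrix (α i) (α j) = CartanMatrix.D ℓ i j

end WeylChar

end

/-! In an orthogonal frame `e` with simple roots `e i - e (i+1)` and a last one `e (ℓ-2) + e (ℓ-1)`
(indices from 0), the roots are the vectors ±`e i` ± `e j` with i ≠ j. An element of the coweight
lattice is thus given by its doubled coordinates: any integer vector whose entries all have the same
parity. Two of them agree modulo qZ exactly if these vectors agree modulo 2q up to adding q to all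
entries (`mk_eq_mk_iff`). So every class has exactly two lifts to tuples over ℤ/2q, and it lies in
M(Φ;q) exactly if the entries of a lift are pairwise different up to sign
(`admissible_coordsMod_iff`). Hence 2χ(w) is the number of such tuples y with wy = y or wy = y +
(q,…,q) (`two_mul_equivChar`).

Since ℓ is even, w₀ acts as -1. The longest element for j = 1 negates all frame vectors except the
first and the last, and the one for j = ℓ reverses the frame; so ω₁ changes the signs of the two
ends and ω_ℓ is the negated reversal. That these really are the longest elements follows from the
exchange condition: it suffices that they lie in the parabolic subgroup and send its simple roots to
negatives of simple roots (`longestElement_eq_inv`). The case ℓ-1 follows from ℓ by the diagram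
automorphism.

What remains is counting. For w = 1 one counts tuples of inequivalent residues under a ↦ -a, where 0
and q are the only fixed residues. For ω₁ the ends must be 0 and q, and the interior is free. For
ω_ℓ opposite entries add up to q, so the first half determines the tuple, and its entries must be
inequivalent under the four maps a ↦ ±a, q ± a with 2a ≠ q. All counts come from
`sepCount_of_card_class` and `sepCount_union_class`; the parities of 0, q and q/2 produce the cases
in q. -/

noncomputable section

namespace WeylChar

/-! ### Counting tuples of pairwise inequivalent elements -/

section Counting

open Finset
open scoped Classical

variable {α : Type*} [Fintype α]

/-- The number of `n`-tuples in `S` whose entries are pairwise inequivalent. -/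
def sepCount (s : Setoid α) (S : Finset α) (n : ℕ) : ℕ :=
  #{y : Fin n → α | (∀ i, y i ∈ S) ∧ ∀ i j, i ≠ j → ¬ s (y i) (y j)}

theorem sepCount_zero (s : Setoid α) (S : Finset α) : sepCount s S 0 = 1 := by
  simp [sepCount]

/-- Once the first entry is a, the others form such a tuple in S without the class of a. -/
theorem sepCount_succ (s : Setoid α) (S : Finset α) (n : ℕ) :
    sepCount s S (n + 1) = ∑ a ∈ S, sepCount s {b ∈ S | ¬ s a b} n := by
  unfold sepCount
  rw [← card_sigma]
  refine card_nbij' (fun y => ⟨y 0, Fin.tail y⟩) (fun p => Fin.cons p.1 p.2) ?_ ?_ ?_ ?_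
  · intro y hy
    simp only [coe_filter, mem_univ, true_and, Set.mem_ofPred_eq] at hy
    simp only [coe_sigma, coe_filter, mem_univ, true_and, Set.mem_sigma_iff, mem_coe, mem_filter,
      Set.mem_ofPred_eq, Fin.tail]
    exact ⟨hy.1 0, fun i => ⟨hy.1 _, hy.2 _ _ (Fin.succ_ne_zero i).symm⟩,
      fun i j hij => hy.2 _ _ (by simpa using hij)⟩
  · rintro ⟨a, z⟩ h
    simp only [coe_sigma, coe_filter, mem_univ, true_and, Set.mem_sigma_iff, mem_coe, mem_filter,
      Set.mem_ofPred_eq] at h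
    simp only [coe_filter, mem_univ, true_and, Set.mem_ofPred_eq]
    refine ⟨fun i => ?_, fun i j hij => ?_⟩
    · refine Fin.cases ?_ (fun i => ?_) i
      · simpa using h.1
      · simpa using (h.2.1 i).1
    · induction i using Fin.cases with
      | zero =>
        induction j using Fin.cases with
        | zero => exact absurd rfl hij
        | succ j => simpa using (h.2.1 j).2
      | succ i =>
        induction j using Fin.cases with
        | zero => simpa using fun h' => (h.2.1 i).2 (s.symm h')
        | succ j => simpa using h.2.2 i j (by simpa using hij)
  · intro y _
    simp
  · rintro ⟨a, z⟩ _
    simp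

/-- Each chosen entry removes its whole class of d elements from S. If the classes run out, one
factor is zero, so the formula needs no bound on n. -/
theorem sepCount_of_card_class (s : Setoid α) (d : ℕ) (n : ℕ) (S : Finset α)
    (h : ∀ a ∈ S, #{b ∈ S | s a b} = d) :
    (sepCount s S n : ℚ) = ∏ k ∈ range n, ((#S : ℚ) - d * k) := by
  induction n generalizing S with
  | zero => simp [sepCount_zero]
  | succ n ih =>
    rw [sepCount_succ, prod_range_succ']
    push_cast
    have key : ∀ a ∈ S, (sepCount s {b ∈ S | ¬ s a b} n : ℚ) =
        ∏ k ∈ range n, ((#S : ℚ) - d * (k + 1)) := by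
      intro a ha
      rw [ih]
      · have h1 := card_filter_add_card_filter_not (s := S) (fun b => s a b)
        rw [h a ha] at h1
        have h2 : (#S : ℚ) = d + #{b ∈ S | ¬ s a b} := by exact_mod_cast h1.symm
        refine prod_congr rfl fun k _ => ?_
        rw [h2]; ring
      · intro c hc
        rw [mem_filter] at hc
        rw [← h c hc.1, filter_filter]
        congr 1
        refine filter_congr fun b _ => ⟨fun hb => hb.2, fun hb => ⟨fun hab => ?_, hb⟩⟩
        exact hc.2 (s.trans hab (s.symm hb))
    rw [sum_congr rfl key]
    simp [mul_comm]

/-- At most one entry can lie in T, since T is contained in one class; it has n + 1 possible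
positions and #T possible values. -/
theorem sepCount_union_class [DecidableEq α] (s : Setoid α) (n : ℕ) (S T : Finset α)
    (hT : ∀ a ∈ T, ∀ b ∈ T, s a b) (hST : ∀ a ∈ S, ∀ b ∈ T, ¬ s a b) :
    sepCount s (S ∪ T) (n + 1) = sepCount s S (n + 1) + (n + 1) * #T * sepCount s S n := by
  have hdis : Disjoint S T := disjoint_left.2 fun a ha hb => hST a ha a hb (s.refl a)
  induction n generalizing S with
  | zero =>
    rw [sepCount_succ, sepCount_succ]
    simp [sepCount_zero, card_union_of_disjoint hdis]
  | succ n ih =>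
    rw [sepCount_succ, sum_union hdis]
    have h1 : ∀ a ∈ S, sepCount s {b ∈ S ∪ T | ¬ s a b} (n + 1) =
        sepCount s {b ∈ S | ¬ s a b} (n + 1) + (n + 1) * #T * sepCount s {b ∈ S | ¬ s a b} n := by
      intro a ha
      rw [filter_union, filter_true_of_mem (s := T) (fun b hb => hST a ha b hb)]
      exact ih _ (fun c hc b hb => hST c (mem_filter.1 hc).1 b hb)
        (hdis.mono_left (filter_subset _ _))
    have h2 : ∀ a ∈ T, sepCount s {b ∈ S ∪ T | ¬ s a b} (n + 1) = sepCount s S (n + 1) := by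
      intro a ha
      congr 1
      rw [filter_union, filter_true_of_mem (s := S) (p := fun b => ¬ s a b)
          (fun b hb h => hST b hb a ha (s.symm h)),
        filter_false_of_mem (s := T) (p := fun b => ¬ s a b)
          (fun b hb h => h (hT a ha b hb)), union_empty]
    rw [sum_congr rfl h1, sum_congr rfl h2, sum_add_distrib, ← mul_sum, ← sepCount_succ,
      ← sepCount_succ, sum_const, smul_eq_mul]
    ring

end Counting

/-! ### Residues modulo 2q up to sign, separated by parity -/

section Residues

open Finset
open scoped Classical

variable (q : ℕ)

/-- The parity of a residue modulo `2q`. -/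
def parity : ZMod (2 * q) →+* ZMod 2 := ZMod.castHom (Dvd.intro q rfl) (ZMod 2)

/-- The relation 2q = 0, in the form in which the later linear combinations use it. -/
theorem natCast_add_self : (q : ZMod (2 * q)) + q = 0 := by
  have h := ZMod.natCast_self (2 * q)
  push_cast at h
  rw [← h]; ring

theorem parity_natCast (n : ℕ) : parity q n = n := map_natCast _ _

variable {q} in
theorem two_mul_eq_zero_iff (hq : 0 < q) (a : ZMod (2 * q)) : 2 * a = 0 ↔ a = 0 ∨ a = q := by
  have : NeZero (2 * q) := ⟨by omega⟩
  have ha : ((a.val : ℕ) : ZMod (2 * q)) = a := ZMod.natCast_zmod_val a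
  have hlt := ZMod.val_lt a
  constructor
  · intro h
    have h2 : ((2 * a.val : ℕ) : ZMod (2 * q)) = 0 := by push_cast; rw [ha, h]
    rw [ZMod.natCast_eq_zero_iff] at h2
    obtain ⟨c, hc⟩ := Nat.dvd_of_mul_dvd_mul_left two_pos h2
    have hc2 : c < 2 := by
      by_contra hge
      have : q * 2 ≤ q * c := Nat.mul_le_mul_left _ (by omega)
      omega
    interval_cases c
    · left; rw [← ha, hc]; simp
    · right; rw [← ha, hc]; simp
  · rintro (rfl | rfl)
    · simp
    · linear_combination natCast_add_self q

variable {q} in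
theorem natCast_ne_zero (hq : 0 < q) : (q : ZMod (2 * q)) ≠ 0 := by
  rw [Ne, ZMod.natCast_eq_zero_iff]
  exact fun h => absurd (Nat.le_of_dvd hq h) (by omega)

theorem neg_natCast : -(q : ZMod (2 * q)) = q := by
  linear_combination -natCast_add_self q

/-- Residues up to sign. -/
def signSetoid (m : ℕ) : Setoid (ZMod m) where
  r a b := a = b ∨ a = -b
  iseqv :=
    { refl := fun a => Or.inl rfl
      symm := by rintro a b (rfl | rfl) <;> simp
      trans := by rintro a b c (rfl | rfl) (rfl | rfl) <;> simp }

theorem signSetoid_iff {m : ℕ} {a b : ZMod m} : signSetoid m a b ↔ a = b ∨ a = -b := Iff.rfl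

/-- Residues modulo `2q` up to sign and translation by `q`. -/
def kleinSetoid : Setoid (ZMod (2 * q)) where
  r a b := a = b ∨ a = -b ∨ a = q - b ∨ a = q + b
  iseqv :=
    { refl := fun a => Or.inl rfl
      symm := by
        have h := neg_natCast q
        rintro a b (rfl | rfl | rfl | rfl)
        · simp
        · simp
        · simp
        · right; right; right; linear_combination -natCast_add_self q
      trans := by
        have h := natCast_add_self q
        rintro a b c (rfl | rfl | rfl | rfl) (rfl | rfl | rfl | rfl)
        · simp
        · simp
        · simp
        · simp
        · simp
        · simp
        · right; right; right; linear_combination -h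
        · right; right; left; linear_combination -h
        · simp
        · simp
        · simp
        · right; left; linear_combination
        · simp
        · right; right; left; linear_combination
        · right; left; linear_combination h
        · left; linear_combination h }

theorem kleinSetoid_iff {a b : ZMod (2 * q)} :
    kleinSetoid q a b ↔ a = b ∨ a = -b ∨ a = q - b ∨ a = q + b := Iff.rfl

theorem parity_neg (a : ZMod (2 * q)) : parity q (-a) = parity q a := by
  rw [map_neg, ZMod.neg_eq_self_mod_two]

section Finite

variable [Fintype (ZMod (2 * q))]

/-- The residues modulo `2q` of a given parity. -/
def level (p : ZMod 2) : Finset (ZMod (2 * q)) := {a | parity q a = p}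

theorem mem_level {p : ZMod 2} {a : ZMod (2 * q)} : a ∈ level q p ↔ parity q a = p := by
  simp [level]

theorem card_level (p : ZMod 2) : #(level q p) = q := by
  have h01 : #(level q 0) = #(level q 1) := by
    -- Translation by 1 exchanges the two parities, so each has half of the 2q residues.
    refine card_nbij' (· + 1) (· - 1) ?_ ?_ ?_ ?_
    · intro a ha
      simp only [mem_coe, mem_level] at ha ⊢
      simp [ha]
    · intro a ha
      simp only [mem_coe, mem_level] at ha ⊢
      simp [ha]
    · intro a _; simp
    · intro a _; simp
  have h2 : #(level q 0) + #(level q 1) = 2 * q := by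
    have h := card_filter_add_card_filter_not (s := (univ : Finset (ZMod (2 * q))))
      (fun a => parity q a = 0)
    rw [card_univ, ZMod.card] at h
    have h1 : level q 1 = ({a | ¬ parity q a = 0} : Finset (ZMod (2 * q))) := by
      ext a
      simp only [level, mem_filter, mem_univ, true_and]
      generalize parity q a = x
      revert x; decide
    rw [h1]
    exact h
  have : p = 0 ∨ p = 1 := by revert p; decide
  rcases this with rfl | rfl <;> omega

/-- The residues of a given parity different from `0` and `q`. -/
def moving (p : ZMod 2) : Finset (ZMod (2 * q)) := {a ∈ level q p | 2 * a ≠ 0}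

/-- The residues of a given parity among `0` and `q`. -/
def torsion (p : ZMod 2) : Finset (ZMod (2 * q)) := {a ∈ level q p | 2 * a = 0}

theorem moving_union_torsion (p : ZMod 2) : moving q p ∪ torsion q p = level q p := by
  ext a; simp only [moving, torsion, mem_union, mem_filter]; tauto

theorem card_moving_add (p : ZMod 2) : #(moving q p) + #(torsion q p) = q := by
  rw [← card_union_of_disjoint, moving_union_torsion, card_level]
  exact disjoint_left.2 fun a ha hb => (mem_filter.1 ha).2 (mem_filter.1 hb).2

/-- Away from 0 and q, the residues a and -a are distinct and have the same parity, so all classes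
have two elements. -/
theorem sepCount_moving (p : ZMod 2) (n : ℕ) :
    (sepCount (signSetoid (2 * q)) (moving q p) n : ℚ) =
      ∏ k ∈ range n, ((#(moving q p) : ℚ) - 2 * k) := by
  refine sepCount_of_card_class _ 2 n _ fun a ha => ?_
  simp only [moving, mem_filter, mem_level] at ha
  have : {b ∈ moving q p | signSetoid (2 * q) a b} = {a, -a} := by
    ext b
    simp only [moving, mem_filter, mem_level, signSetoid_iff, mem_insert, mem_singleton]
    constructor
    · rintro ⟨_, rfl | rfl⟩ <;> simp
    · rintro (rfl | rfl)
      · exact ⟨ha, Or.inl rfl⟩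
      · refine ⟨⟨by rw [parity_neg, ha.1], fun h => ha.2 ?_⟩, by simp⟩
        linear_combination -h
  rw [this, card_pair]
  intro h
  exact ha.2 (by linear_combination h)

variable {q} (hq : 0 < q)
include hq

/-- For odd q, the residue 0 is even and q is odd, so each parity contains exactly one residue equal
to its negative. -/
theorem torsion_of_odd (h : ¬ 2 ∣ q) (p : ZMod 2) : #(torsion q p) = 1 := by
  have hq2 : (q : ZMod 2) = 1 := by
    rw [ZMod.natCast_eq_one_iff_odd, ← Nat.not_even_iff_odd, even_iff_two_dvd]; exact h
  have : p = 0 ∨ p = 1 := by revert p; decide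
  rw [card_eq_one]
  rcases this with rfl | rfl
  · refine ⟨0, ?_⟩
    ext a
    simp only [torsion, mem_filter, mem_level, two_mul_eq_zero_iff hq, mem_singleton]
    constructor
    · rintro ⟨h1, rfl | rfl⟩
      · rfl
      · rw [parity_natCast, hq2] at h1; exact absurd h1 (by decide)
    · rintro rfl; simp
  · refine ⟨(q : ZMod (2 * q)), ?_⟩
    ext a
    simp only [torsion, mem_filter, mem_level, two_mul_eq_zero_iff hq, mem_singleton]
    constructor
    · rintro ⟨h1, rfl | rfl⟩
      · rw [map_zero] at h1; exact absurd h1 (by decide)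
      · rfl
    · rintro rfl; simp [hq2]

theorem torsion_zero_of_even (h : 2 ∣ q) : torsion q 0 = {0, (q : ZMod (2 * q))} := by
  have hq2 : (q : ZMod 2) = 0 := by rwa [ZMod.natCast_eq_zero_iff]
  ext a
  simp only [torsion, mem_filter, mem_level, two_mul_eq_zero_iff hq, mem_singleton, mem_insert]
  constructor
  · exact fun h => h.2
  · rintro (rfl | rfl)
    · simp
    · simp [hq2]

theorem torsion_one_of_even (h : 2 ∣ q) : torsion q 1 = ∅ := by
  have hq2 : (q : ZMod 2) = 0 := by rwa [ZMod.natCast_eq_zero_iff]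
  ext a
  simp only [torsion, mem_filter, mem_level, two_mul_eq_zero_iff hq, notMem_empty, iff_false]
  rintro ⟨h1, rfl | rfl⟩
  · rw [map_zero] at h1; exact absurd h1 (by decide)
  · rw [parity_natCast, hq2] at h1; exact absurd h1 (by decide)

/-- The single self-negative residue is used in no entry or in one of n + 1 places, and (q - 1 - 2n)
+ (n + 1) = q - n. -/
theorem sepCount_level_of_odd (h : ¬ 2 ∣ q) (p : ZMod 2) (n : ℕ) :
    (sepCount (signSetoid (2 * q)) (level q p) (n + 1) : ℚ) =
      (∏ k ∈ range n, ((q : ℚ) - 1 - 2 * k)) * (q - n) := by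
  have ht := torsion_of_odd hq h p
  have hm := card_moving_add q p
  have hm' : (#(moving q p) : ℚ) = q - 1 := by
    rw [ht] at hm; rw [eq_sub_iff_add_eq]; exact_mod_cast hm
  rw [← moving_union_torsion, sepCount_union_class]
  · push_cast
    rw [sepCount_moving, sepCount_moving, ht, hm', prod_range_succ]
    push_cast; ring
  · obtain ⟨c, hc⟩ := card_eq_one.1 ht
    simp only [hc, mem_singleton]
    rintro a rfl b rfl
    exact Or.inl rfl
  · intro a ha b hb
    rw [moving, mem_filter] at ha
    rw [torsion, mem_filter] at hb
    rintro (rfl | rfl)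
    · exact ha.2 hb.2
    · exact ha.2 (by linear_combination -hb.2)

theorem sepCount_level_one_of_even (h : 2 ∣ q) (n : ℕ) :
    (sepCount (signSetoid (2 * q)) (level q 1) n : ℚ) = ∏ k ∈ range n, ((q : ℚ) - 2 * k) := by
  have hm := card_moving_add q 1
  rw [torsion_one_of_even hq h, card_empty, add_zero] at hm
  rw [← moving_union_torsion, torsion_one_of_even hq h, union_empty, sepCount_moving, hm]

theorem card_moving_zero_of_even (h : 2 ∣ q) : (#(moving q 0) : ℚ) = q - 2 := by
  have hm := card_moving_add q 0
  rw [torsion_zero_of_even hq h, card_pair (natCast_ne_zero hq).symm] at hm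
  rw [eq_sub_iff_add_eq]; exact_mod_cast hm

/-- For even q, both 0 and q are even and form two separate singleton classes. They are adjoined to
the residues outside them one at a time, q first and then 0. -/
theorem sepCount_level_zero_of_even (h : 2 ∣ q) (n : ℕ) :
    (sepCount (signSetoid (2 * q)) (level q 0) (n + 2) : ℚ) =
      (∏ k ∈ range n, ((q : ℚ) - 2 - 2 * k)) * (q * (q - 2 * (n + 1)) + (n + 2) * (n + 1)) := by
  have ht := torsion_zero_of_even hq h
  have hm' := card_moving_zero_of_even hq h
  have hq0 := natCast_ne_zero hq
  have hmov : ∀ a ∈ moving q 0, ∀ b : ZMod (2 * q), 2 * b = 0 → ¬ signSetoid (2 * q) a b := by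
    intro a ha b hb
    rw [moving, mem_filter] at ha
    rintro (rfl | rfl)
    · exact ha.2 hb
    · exact ha.2 (by linear_combination -hb)
  have h2 : 2 * (q : ZMod (2 * q)) = 0 := (two_mul_eq_zero_iff hq _).2 (Or.inr rfl)
  have key : ∀ n, sepCount (signSetoid (2 * q)) (moving q 0 ∪ {(q : ZMod (2 * q))}) (n + 1) =
      sepCount (signSetoid (2 * q)) (moving q 0) (n + 1) +
        (n + 1) * 1 * sepCount (signSetoid (2 * q)) (moving q 0) n := fun n => by
    rw [sepCount_union_class, card_singleton]
    · simp only [mem_singleton]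
      rintro a rfl b rfl
      exact Or.inl rfl
    · simp only [mem_singleton]
      rintro a ha b rfl
      exact hmov a ha _ h2
  have hset : level q 0 = (moving q 0 ∪ {(q : ZMod (2 * q))}) ∪ {0} := by
    rw [← moving_union_torsion, ht]
    ext a; simp only [mem_union, mem_insert, mem_singleton]; tauto
  rw [hset, sepCount_union_class, card_singleton, key, key]
  · push_cast
    rw [sepCount_moving, sepCount_moving, sepCount_moving, hm', prod_range_succ, prod_range_succ]
    push_cast; ring
  · simp only [mem_singleton]
    rintro a rfl b rfl
    exact Or.inl rfl
  · simp only [mem_singleton, mem_union]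
    rintro a (ha | rfl) b rfl
    · exact hmov a ha _ (by simp)
    · rintro (h | h)
      · exact hq0 h
      · exact hq0 (by simpa using h)

end Finite

end Residues

/-! ### Residues up to sign and translation by q -/

section ResidueTuples

open Finset
open scoped Classical

variable (q : ℕ) [Fintype (ZMod (2 * q))]

/-- The residues `a` of a given parity with `2a ≠ 0` and `2a ≠ q`. -/
def kleinMoving (p : ZMod 2) : Finset (ZMod (2 * q)) :=
  {a ∈ level q p | 2 * a ≠ 0 ∧ 2 * a ≠ q}

/-- The residues `a` of a given parity with `2a ≠ q`. -/
def nonHalves (p : ZMod 2) : Finset (ZMod (2 * q)) := {a ∈ level q p | 2 * a ≠ q}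

/-- The residues `a` of a given parity with `2a = q`. -/
def halves (p : ZMod 2) : Finset (ZMod (2 * q)) := {a ∈ level q p | 2 * a = q}

theorem sepCount_kleinMoving (hq : 0 < q) (h2 : 2 ∣ q) (p : ZMod 2) (n : ℕ) :
    (sepCount (kleinSetoid q) (kleinMoving q p) n : ℚ) =
      ∏ k ∈ range n, ((#(kleinMoving q p) : ℚ) - 4 * k) := by
  have hqq := natCast_add_self q
  have hq0 := natCast_ne_zero hq
  have hq2 : (q : ZMod 2) = 0 := by rwa [ZMod.natCast_eq_zero_iff]
  refine sepCount_of_card_class _ 4 n _ fun a ha => ?_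
  simp only [kleinMoving, mem_filter, mem_level] at ha
  obtain ⟨hp, ha0, haq⟩ := ha
  -- These four residues have the same parity because q is even, and they are distinct because 2a is
  -- neither 0 nor q.
  have : {b ∈ kleinMoving q p | kleinSetoid q a b} = {a, -a, q - a, q + a} := by
    ext b
    simp only [kleinMoving, mem_filter, mem_level, kleinSetoid_iff, mem_insert, mem_singleton]
    constructor
    · rintro ⟨_, rfl | rfl | rfl | rfl⟩
      · simp
      · simp
      · simp
      · right; right; right; linear_combination -hqq
    · rintro (rfl | rfl | rfl | rfl)
      · exact ⟨⟨hp, ha0, haq⟩, Or.inl rfl⟩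
      · refine ⟨⟨by rw [parity_neg, hp], fun h => ha0 ?_, fun h => haq ?_⟩, by simp⟩
        · linear_combination -h
        · linear_combination -h - hqq
      · refine ⟨⟨by rw [sub_eq_add_neg, map_add, parity_neg, hp, parity_natCast, hq2, zero_add],
          fun h => ha0 ?_, fun h => haq ?_⟩, by simp⟩
        · linear_combination -h + hqq
        · linear_combination -h
      · refine ⟨⟨by rw [map_add, hp, parity_natCast, hq2, zero_add],
          fun h => ha0 ?_, fun h => haq ?_⟩, ?_⟩
        · linear_combination h - hqq
        · linear_combination h - hqq
        · right; right; right; linear_combination -hqq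
  rw [this, card_insert_of_notMem, card_insert_of_notMem, card_pair]
  · intro h; exact ha0 (by linear_combination -h)
  · simp only [mem_insert, mem_singleton, not_or]
    exact ⟨fun h => hq0 (by linear_combination -h), fun h => haq (by linear_combination -h - hqq)⟩
  · simp only [mem_insert, mem_singleton, not_or]
    exact ⟨fun h => ha0 (by linear_combination h), fun h => haq (by linear_combination h),
      fun h => hq0 (by linear_combination -h)⟩

theorem nonHalves_eq (hq : 0 < q) (p : ZMod 2) :
    nonHalves q p = kleinMoving q p ∪ torsion q p := by
  have hq0 := natCast_ne_zero hq
  ext a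
  simp only [nonHalves, kleinMoving, torsion, mem_filter, mem_union]
  constructor
  · rintro ⟨h1, h2⟩
    by_cases h : 2 * a = 0
    · exact Or.inr ⟨h1, h⟩
    · exact Or.inl ⟨h1, h, h2⟩
  · rintro (⟨h1, h2, h3⟩ | ⟨h1, h2⟩)
    · exact ⟨h1, h3⟩
    · exact ⟨h1, fun h => hq0 (by rw [← h, h2])⟩

theorem card_kleinMoving_add (hq : 0 < q) (p : ZMod 2) :
    #(kleinMoving q p) + #(torsion q p) + #(halves q p) = q := by
  rw [← card_union_of_disjoint, ← nonHalves_eq q hq, halves, nonHalves, add_comm,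
    card_filter_add_card_filter_not, card_level]
  exact disjoint_left.2 fun a ha hb => (mem_filter.1 ha).2.1 (mem_filter.1 hb).2

/-- Translation by q identifies 0 with q, so the torsion residues lie in one class, and at most one
entry is taken from it. -/
theorem sepCount_klein (hq : 0 < q) (h2 : 2 ∣ q) (p : ZMod 2) (n : ℕ) :
    (sepCount (kleinSetoid q) (nonHalves q p) (n + 1) : ℚ) =
      (∏ k ∈ range n, ((#(kleinMoving q p) : ℚ) - 4 * k)) *
        (#(kleinMoving q p) - 4 * n + (n + 1) * #(torsion q p)) := by
  have hqq := natCast_add_self q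
  rw [nonHalves_eq q hq, sepCount_union_class]
  · push_cast
    rw [sepCount_kleinMoving q hq h2, sepCount_kleinMoving q hq h2, prod_range_succ]
    ring
  · intro a ha b hb
    simp only [torsion, mem_filter, two_mul_eq_zero_iff hq] at ha hb
    obtain ⟨-, rfl | rfl⟩ := ha <;> obtain ⟨-, rfl | rfl⟩ := hb <;> simp [kleinSetoid_iff]
  · intro a ha b hb
    simp only [kleinMoving, torsion, mem_filter] at ha hb
    have h0 := ha.2.1
    rintro (rfl | rfl | rfl | rfl)
    · exact h0 hb.2
    · exact h0 (by linear_combination -hb.2)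
    · exact h0 (by linear_combination -hb.2 + hqq)
    · exact h0 (by linear_combination hb.2 + hqq)

/-- With q = 2h the solutions of 2a = q are h and h + q. Both have the parity of h, as q is even; so
they all lie in one parity class. -/
theorem halves_eq_pair (hq : 0 < q) {h : ℕ} (hh : q = 2 * h) (p : ZMod 2) (hp : (h : ZMod 2) = p) :
    #(halves q p) = 2 := by
  have hq2 : (q : ZMod 2) = 0 := by rw [ZMod.natCast_eq_zero_iff]; exact ⟨h, hh⟩
  have hhq : 2 * (h : ZMod (2 * q)) = q := by rw [hh]; push_cast; ring
  have : halves q p = {(h : ZMod (2 * q)), (h : ZMod (2 * q)) + q} := by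
    ext a
    simp only [halves, mem_filter, mem_level, mem_insert, mem_singleton]
    constructor
    · rintro ⟨-, ha⟩
      have := (two_mul_eq_zero_iff hq (a - h)).1 (by linear_combination ha - hhq)
      rcases this with h' | h'
      · left; linear_combination h'
      · right; linear_combination h'
    · rintro (rfl | rfl)
      · exact ⟨by rw [parity_natCast, hp], hhq⟩
      · exact ⟨by rw [map_add, parity_natCast, parity_natCast, hp, hq2, add_zero],
          by linear_combination hhq + natCast_add_self q⟩
  rw [this, card_pair]
  intro h'
  exact natCast_ne_zero hq (by linear_combination -h')

theorem halves_eq_empty (hq : 0 < q) {h : ℕ} (hh : q = 2 * h) (p : ZMod 2) (hp : (h : ZMod 2) ≠ p) :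
    #(halves q p) = 0 := by
  have hq2 : (q : ZMod 2) = 0 := by rw [ZMod.natCast_eq_zero_iff]; exact ⟨h, hh⟩
  have hhq : 2 * (h : ZMod (2 * q)) = q := by rw [hh]; push_cast; ring
  rw [card_eq_zero]
  ext a
  simp only [halves, mem_filter, mem_level, notMem_empty, iff_false]
  rintro ⟨h1, ha⟩
  apply hp
  have := (two_mul_eq_zero_iff hq (a - h)).1 (by linear_combination ha - hhq)
  rcases this with h' | h'
  · rw [← h1, sub_eq_zero.1 h', parity_natCast]
  · rw [← h1, sub_eq_iff_eq_add.1 h', map_add, parity_natCast, parity_natCast, hq2, zero_add]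

theorem card_torsion_zero (hq : 0 < q) (h2 : 2 ∣ q) : #(torsion q 0) = 2 := by
  rw [torsion_zero_of_even hq h2, card_pair (natCast_ne_zero hq).symm]

/-- Here q/2 is odd. The even level loses {0, q} and the odd level loses the two halves of q, so
both have q - 2 residues in classes of size four; only the even level has a torsion class to add. -/
theorem sepCount_klein_sum_of_gcd_eq_two (hq : 0 < q) (hg : Nat.gcd 4 q = 2) (n : ℕ) :
    (sepCount (kleinSetoid q) (nonHalves q 0) (n + 1) : ℚ) +
      sepCount (kleinSetoid q) (nonHalves q 1) (n + 1) =
      2 * ((∏ k ∈ range n, ((q : ℚ) - 2 - 4 * k)) * (q - 3 * n - 1)) := by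
  have h2 : 2 ∣ q := hg ▸ Nat.gcd_dvd_right 4 q
  obtain ⟨h, hh⟩ := h2
  have hodd : (h : ZMod 2) = 1 := by
    rw [ZMod.natCast_eq_one_iff_odd, ← Nat.not_even_iff_odd]
    rintro ⟨c, hc⟩
    have : 4 ∣ Nat.gcd 4 q := Nat.dvd_gcd dvd_rfl ⟨c, by omega⟩
    rw [hg] at this; omega
  have c0 := card_kleinMoving_add q hq 0
  have c1 := card_kleinMoving_add q hq 1
  rw [halves_eq_empty q hq hh 0 (by rw [hodd]; decide), card_torsion_zero q hq ⟨h, hh⟩] at c0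
  rw [halves_eq_pair q hq hh 1 hodd, torsion_one_of_even hq ⟨h, hh⟩, card_empty] at c1
  have c0' : (#(kleinMoving q 0) : ℚ) = q - 2 := by rw [eq_sub_iff_add_eq]; exact_mod_cast c0
  have c1' : (#(kleinMoving q 1) : ℚ) = q - 2 := by rw [eq_sub_iff_add_eq]; exact_mod_cast c1
  rw [sepCount_klein q hq ⟨h, hh⟩, sepCount_klein q hq ⟨h, hh⟩, c0', c1',
    card_torsion_zero q hq ⟨h, hh⟩, torsion_one_of_even hq ⟨h, hh⟩, card_empty]
  push_cast; ring

/-- Here q/2 is even, so the even level loses both {0, q} and the two halves of q, while the odd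
level consists of q residues in classes of size four. -/
theorem sepCount_klein_sum_of_gcd_eq_four (hq : 0 < q) (hg : Nat.gcd 4 q = 4) (n : ℕ) :
    (sepCount (kleinSetoid q) (nonHalves q 0) (n + 1) : ℚ) +
      sepCount (kleinSetoid q) (nonHalves q 1) (n + 1) =
      2 * ((∏ k ∈ range n, ((q : ℚ) - 4 * (k + 1))) * (q - n - 1)) := by
  obtain ⟨c, hc⟩ : 4 ∣ q := hg ▸ Nat.gcd_dvd_right 4 q
  have hh : q = 2 * (2 * c) := by omega
  have heven : ((2 * c : ℕ) : ZMod 2) = 0 := by rw [ZMod.natCast_eq_zero_iff]; exact ⟨c, rfl⟩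
  have h2 : 2 ∣ q := ⟨_, hh⟩
  have c0 := card_kleinMoving_add q hq 0
  have c1 := card_kleinMoving_add q hq 1
  rw [halves_eq_pair q hq hh 0 heven, card_torsion_zero q hq h2] at c0
  rw [halves_eq_empty q hq hh 1 (by rw [heven]; decide), torsion_one_of_even hq h2,
    card_empty] at c1
  have c0' : (#(kleinMoving q 0) : ℚ) = q - 4 := by rw [eq_sub_iff_add_eq]; exact_mod_cast c0
  have c1' : (#(kleinMoving q 1) : ℚ) = q := by exact_mod_cast c1
  rw [sepCount_klein q hq h2, sepCount_klein q hq h2, c0', c1',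
    card_torsion_zero q hq h2, torsion_one_of_even hq h2, card_empty]
  -- Splitting off the first instead of the last factor of the odd level's product exposes the
  -- factor common to both levels.
  have e : (∏ k ∈ range n, ((q : ℚ) - 4 * k)) * (q - 4 * n) =
      q * ∏ k ∈ range n, ((q : ℚ) - 4 * (k + 1)) := by
    rw [← prod_range_succ (fun k : ℕ => (q : ℚ) - 4 * k), prod_range_succ']
    push_cast; ring
  have e' : ∏ k ∈ range n, ((q : ℚ) - 4 - 4 * k) = ∏ k ∈ range n, ((q : ℚ) - 4 * (k + 1)) :=
    prod_congr rfl fun k _ => by ring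
  rw [e']
  push_cast
  linear_combination e

/-! ### Tuples of residues off the hyperplanes of type `D` -/

/-- The tuples of residues of equal parity that are pairwise different up to sign. -/
def Admissible {ℓ : ℕ} (y : Fin ℓ → ZMod (2 * q)) : Prop :=
  (∀ i j, parity q (y i) = parity q (y j)) ∧ ∀ i j, i ≠ j → ¬ signSetoid (2 * q) (y i) (y j)

theorem card_equal_parity {ℓ : ℕ} (i₀ : Fin ℓ) (Q : (Fin ℓ → ZMod (2 * q)) → Prop) :
    #{y : Fin ℓ → ZMod (2 * q) | (∀ i j, parity q (y i) = parity q (y j)) ∧ Q y} =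
      #{y : Fin ℓ → ZMod (2 * q) | (∀ i, y i ∈ level q 0) ∧ Q y} +
        #{y : Fin ℓ → ZMod (2 * q) | (∀ i, y i ∈ level q 1) ∧ Q y} := by
  rw [card_eq_sum_card_fiberwise (f := fun y => parity q (y i₀)) (t := univ) (by simp)]
  have : (univ : Finset (ZMod 2)) = {0, 1} := by decide
  rw [this, sum_pair (by decide)]
  congr 2 <;>
  · ext y
    simp only [mem_filter, mem_univ, true_and, mem_level]
    constructor
    · rintro ⟨⟨h1, h2⟩, h3⟩
      exact ⟨fun i => (h1 i i₀).trans h3, h2⟩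
    · rintro ⟨h1, h2⟩
      exact ⟨⟨fun i j => (h1 i).trans (h1 j).symm, h2⟩, h1 i₀⟩

theorem card_admissible {ℓ : ℕ} (hℓ : 0 < ℓ) :
    #{y : Fin ℓ → ZMod (2 * q) | Admissible q y} =
      sepCount (signSetoid (2 * q)) (level q 0) ℓ + sepCount (signSetoid (2 * q)) (level q 1) ℓ := by
  unfold sepCount
  convert card_equal_parity q ⟨0, hℓ⟩ fun y => ∀ i j, i ≠ j → ¬ signSetoid (2 * q) (y i) (y j)
  rfl

/-- For odd q both parities contribute equally. The factor 2 in this and the following counts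
cancels against the two lifts of each class. -/
theorem card_admissible_of_odd (hq : 0 < q) (h : ¬ 2 ∣ q) (n : ℕ) :
    (#{y : Fin (n + 1) → ZMod (2 * q) | Admissible q y} : ℚ) =
      2 * ((∏ k ∈ range n, ((q : ℚ) - 1 - 2 * k)) * (q - n)) := by
  rw [card_admissible q (Nat.succ_pos n)]
  push_cast
  rw [sepCount_level_of_odd hq h, sepCount_level_of_odd hq h]
  ring

theorem card_admissible_of_even (hq : 0 < q) (h : 2 ∣ q) (n : ℕ) :
    (#{y : Fin (n + 2) → ZMod (2 * q) | Admissible q y} : ℚ) =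
      2 * ((∏ k ∈ range n, ((q : ℚ) - 2 * (k + 1))) *
        (q ^ 2 - 2 * (n + 1) * q + (n + 2) * (n + 1) / 2)) := by
  rw [card_admissible q (by omega)]
  push_cast
  rw [sepCount_level_zero_of_even hq h, sepCount_level_one_of_even hq h, prod_range_succ,
    prod_range_succ']
  have e' : ∏ k ∈ range n, ((q : ℚ) - 2 - 2 * k) = ∏ k ∈ range n, ((q : ℚ) - 2 * (k + 1)) :=
    prod_congr rfl fun k _ => by ring
  rw [e']
  push_cast
  ring


/-! ### Tuples fixed, up to translation by q, by the sign change of the ends and by the negated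
reversal -/

/-- The tuple obtained from `y` by changing the signs of the first and the last entry. -/
def negEnds {ℓ : ℕ} {A : Type*} [Neg A] (y : Fin ℓ → A) : Fin ℓ → A :=
  fun i => if (i : ℕ) = 0 ∨ (i : ℕ) = ℓ - 1 then -y i else y i

/-- The tuple obtained from `y` by reversing the order and changing all signs. -/
def negRev {ℓ : ℕ} {A : Type*} [Neg A] (y : Fin ℓ → A) : Fin ℓ → A := fun i => -y i.rev

omit [Fintype (ZMod (2 * q))] in
theorem negEnds_fixed_iff (hq : 0 < q) {n : ℕ} (hn : 0 < n) (y : Fin (n + 2) → ZMod (2 * q)) :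
    (negEnds y = y ∨ negEnds y = fun i => y i + q) ↔
      2 * y 0 = 0 ∧ 2 * y (Fin.last (n + 1)) = 0 := by
  constructor
  · rintro (h | h)
    · have h0 := congrFun h 0
      have h1 := congrFun h (Fin.last (n + 1))
      simp only [negEnds, Fin.val_zero, true_or, if_true, Fin.val_last] at h0 h1
      rw [if_pos (by omega)] at h1
      exact ⟨by linear_combination -h0, by linear_combination -h1⟩
    -- Since n > 0, position 1 is interior and its entry is unchanged, so no translation by q can
    -- occur.
    · have h0 := congrFun h ⟨1, by omega⟩
      simp only [negEnds] at h0
      rw [if_neg (by omega)] at h0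
      exact absurd (by linear_combination -h0) (natCast_ne_zero hq)
  · rintro ⟨h0, h1⟩
    left
    funext i
    simp only [negEnds]
    split_ifs with h
    · rcases h with h | h
      · have : i = 0 := Fin.ext h
        rw [this]; linear_combination -h0
      · have : i = Fin.last (n + 1) := Fin.ext h
        rw [this]; linear_combination -h1
    · rfl

/-- Both ends would have to be the only self-negative residue of their common parity, hence equal.
-/
theorem card_admissible_negEnds_of_odd (hq : 0 < q) (h : ¬ 2 ∣ q) {n : ℕ} (hn : 0 < n) :
    #{y : Fin (n + 2) → ZMod (2 * q) | Admissible q y ∧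
      (negEnds y = y ∨ negEnds y = fun i => y i + q)} = 0 := by
  rw [card_eq_zero, filter_eq_empty_iff]
  rintro y - ⟨⟨h1, h2⟩, h3⟩
  rw [negEnds_fixed_iff q hq hn] at h3
  obtain ⟨c, hc⟩ := card_eq_one.1 (torsion_of_odd hq h (parity q (y 0)))
  have e0 : y 0 ∈ torsion q (parity q (y 0)) := by simp [torsion, mem_level, h3.1]
  have e1 : y (Fin.last (n + 1)) ∈ torsion q (parity q (y 0)) := by
    simp [torsion, mem_level, h3.2, h1 (Fin.last (n + 1)) 0]
  rw [hc, mem_singleton] at e0 e1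
  exact h2 0 (Fin.last (n + 1)) (Fin.last_pos.ne) (Or.inl (e0.trans e1.symm))

theorem card_admissible_negEnds_of_even (hq : 0 < q) (h : 2 ∣ q) {n : ℕ} (hn : 0 < n) :
    (#{y : Fin (n + 2) → ZMod (2 * q) | Admissible q y ∧
      (negEnds y = y ∨ negEnds y = fun i => y i + q)} : ℚ) =
      2 * ∏ k ∈ range n, ((q : ℚ) - 2 * (k + 1)) := by
  have hq2 : (q : ZMod 2) = 0 := by rwa [ZMod.natCast_eq_zero_iff]
  have hqq := natCast_add_self q
  have hq0 := natCast_ne_zero hq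
  have hpar : ∀ a : ZMod (2 * q), 2 * a = 0 → parity q a = 0 := by
    intro a ha
    rcases (two_mul_eq_zero_iff hq a).1 ha with rfl | rfl
    · exact map_zero _
    · rw [parity_natCast, hq2]
  have hopp : ∀ a b : ZMod (2 * q), 2 * a = 0 → 2 * b = 0 → a ≠ b → a + q = b := by
    intro a b ha hb hab
    rw [two_mul_eq_zero_iff hq] at ha hb
    rcases ha with rfl | rfl <;> rcases hb with rfl | rfl
    · exact absurd rfl hab
    · exact zero_add _
    · exact hqq
    · exact absurd rfl hab
  have hsep : ∀ a b : ZMod (2 * q), 2 * a = 0 → 2 * b ≠ 0 → ¬ signSetoid (2 * q) a b := by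
    rintro a b ha hb (rfl | rfl)
    · exact hb ha
    · exact hb (by linear_combination -ha)
  have key : #{y : Fin (n + 2) → ZMod (2 * q) | Admissible q y ∧
      (negEnds y = y ∨ negEnds y = fun i => y i + q)} =
      #(torsion q 0 ×ˢ ({z : Fin n → ZMod (2 * q) | (∀ i, z i ∈ moving q 0) ∧
        ∀ i j, i ≠ j → ¬ signSetoid (2 * q) (z i) (z j)} : Finset _)) := by
    simp_rw [negEnds_fixed_iff q hq hn]
    -- The ends are 0 and q in some order: the first end is a free torsion residue a, the last is
    -- then a + q, and the interior avoids both.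
    refine card_nbij' (fun y => (y 0, fun i : Fin n => y i.castSucc.succ))
      (fun p => Fin.cons p.1 (Fin.snoc p.2 (p.1 + q) : Fin (n + 1) → ZMod (2 * q))) ?_ ?_ ?_ ?_
    · intro y hy
      simp only [coe_filter, mem_univ, true_and, Set.mem_ofPred_eq] at hy
      obtain ⟨⟨h1, h2⟩, h3, h4⟩ := hy
      simp only [coe_product, Set.mem_prod, mem_coe, mem_filter, mem_univ, true_and, torsion,
        mem_level, moving]
      refine ⟨⟨hpar _ h3, h3⟩, fun i => ⟨(h1 _ 0).trans (hpar _ h3), fun h5 => ?_⟩,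
        fun i j hij => h2 _ _ (by simpa using hij)⟩
      have e1 := hopp _ _ h3 h4 fun e => h2 0 (Fin.last (n + 1)) Fin.last_pos.ne (Or.inl e)
      have e2 := hopp _ _ h3 h5 fun e => h2 0 i.castSucc.succ (Fin.succ_ne_zero _).symm (Or.inl e)
      refine h2 i.castSucc.succ (Fin.last (n + 1)) ?_ (Or.inl (e2.symm.trans e1))
      rw [← Fin.succ_last]
      exact fun e => (Fin.castSucc_lt_last i).ne (Fin.succ_injective _ e)
    · rintro ⟨a, z⟩ hz
      simp only [coe_product, Set.mem_prod, mem_coe, mem_filter, mem_univ, true_and, torsion,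
        mem_level, moving] at hz
      obtain ⟨⟨ha1, ha2⟩, hz1, hz2⟩ := hz
      have haq : 2 * (a + q) = 0 := by linear_combination ha2 + hqq
      simp only [coe_filter, mem_univ, true_and, Set.mem_ofPred_eq]
      refine ⟨⟨?_, ?_⟩, by simpa using ha2, ?_⟩
      · have : ∀ i, parity q ((Fin.cons a (Fin.snoc z (a + q) : Fin (n + 1) → ZMod (2 * q)) :
            Fin (n + 2) → ZMod (2 * q)) i) = 0 := by
          intro i
          induction i using Fin.cases with
          | zero => simpa using ha1
          | succ i =>
            induction i using Fin.lastCases with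
            | last => simpa using hpar _ haq
            | cast i => simpa using (hz1 i).1
        intro i j
        rw [this, this]
      · have haa : ¬ signSetoid (2 * q) a (a + q) := by
          rintro (e | e)
          · exact hq0 (by linear_combination -e)
          · exact hq0 (by linear_combination e - ha2)
        intro i j hij
        induction i using Fin.cases with
        | zero =>
          induction j using Fin.cases with
          | zero => exact absurd rfl hij
          | succ j =>
            induction j using Fin.lastCases with
            | last => simpa using haa
            | cast j => simpa using hsep _ _ ha2 (hz1 j).2
        | succ i =>
          induction i using Fin.lastCases with
          | last =>
            induction j using Fin.cases with
            | zero => simpa using fun e => haa (Setoid.symm' _ e)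
            | succ j =>
              induction j using Fin.lastCases with
              | last => exact absurd rfl hij
              | cast j => simpa using hsep _ _ haq (hz1 j).2
          | cast i =>
            induction j using Fin.cases with
            | zero => simpa using fun e => hsep _ _ ha2 (hz1 i).2 (Setoid.symm' _ e)
            | succ j =>
              induction j using Fin.lastCases with
              | last => simpa using fun e => hsep _ _ haq (hz1 i).2 (Setoid.symm' _ e)
              | cast j => simpa using hz2 i j (by simpa using hij)
      · rw [← Fin.succ_last, Fin.cons_succ, Fin.snoc_last]
        exact haq
    · intro y hy
      simp only [coe_filter, mem_univ, true_and, Set.mem_ofPred_eq] at hy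
      obtain ⟨⟨h1, h2⟩, h3, h4⟩ := hy
      have e1 := hopp _ _ h3 h4 fun e => h2 0 (Fin.last (n + 1)) Fin.last_pos.ne (Or.inl e)
      funext i
      induction i using Fin.cases with
      | zero => simp
      | succ i =>
        induction i using Fin.lastCases with
        | last => simpa using e1
        | cast i => simp
    · rintro ⟨a, z⟩ _
      simp
  rw [key, card_product, card_torsion_zero q hq h]
  have := sepCount_moving q 0 n
  rw [card_moving_zero_of_even hq h] at this
  unfold sepCount at this
  have e' : ∏ k ∈ range n, ((q : ℚ) - 2 - 2 * k) = ∏ k ∈ range n, ((q : ℚ) - 2 * (k + 1)) :=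
    prod_congr rfl fun k _ => by ring
  rw [e'] at this
  rw [← this]
  push_cast
  congr!

omit [Fintype (ZMod (2 * q))] in
-- A tuple genuinely fixed would have opposite entries that are negatives of each other, which is
-- excluded; only the translation by q remains.
theorem negRev_fixed_iff {n : ℕ} (hn : 0 < n) (y : Fin (2 * n) → ZMod (2 * q))
    (hy : ∀ i j, i ≠ j → ¬ signSetoid (2 * q) (y i) (y j)) :
    (negRev y = y ∨ negRev y = fun i => y i + q) ↔ ∀ i, y i + y i.rev = q := by
  have hqq := natCast_add_self q
  constructor
  · rintro (h | h)
    · exfalso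
      refine hy ⟨0, by omega⟩ (Fin.rev ⟨0, by omega⟩) ?_ (Or.inr (congrFun h _).symm)
      rw [Ne, Fin.ext_iff, Fin.val_rev]; simp; omega
    · intro i
      have := congrFun h i
      simp only [negRev] at this
      linear_combination -this - hqq
  · intro h
    right
    funext i
    simp only [negRev]
    linear_combination -h i - hqq

theorem card_admissible_negRev_of_odd (h : ¬ 2 ∣ q) {n : ℕ} (hn : 0 < n) :
    #{y : Fin (2 * n) → ZMod (2 * q) | Admissible q y ∧
      (negRev y = y ∨ negRev y = fun i => y i + q)} = 0 := by
  have hq2 : (q : ZMod 2) = 1 := by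
    rw [ZMod.natCast_eq_one_iff_odd, ← Nat.not_even_iff_odd, even_iff_two_dvd]; exact h
  rw [card_eq_zero, filter_eq_empty_iff]
  rintro y - ⟨⟨h1, h2⟩, h3⟩
  rw [negRev_fixed_iff q hn y h2] at h3
  -- Two entries of equal parity have an even sum, which cannot be the odd number q.
  have h4 := congrArg (parity q) (h3 ⟨0, by omega⟩)
  rw [map_add, h1 (Fin.rev _) ⟨0, by omega⟩, parity_natCast, hq2] at h4
  generalize parity q (y ⟨0, by omega⟩) = x at h4
  revert x; decide

/-- The tuple with first half `z` whose entries at opposite positions add up to `q`. -/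
def foldTuple {n : ℕ} (z : Fin n → ZMod (2 * q)) (j : Fin (2 * n)) : ZMod (2 * q) :=
  if h : (j : ℕ) < n then z ⟨j, h⟩ else q - z ⟨2 * n - 1 - j, by omega⟩

/-- The inclusion of the first half. -/
def firstHalf {n : ℕ} (i : Fin n) : Fin (2 * n) := ⟨i, by omega⟩

omit [Fintype (ZMod (2 * q))] in
theorem foldTuple_firstHalf {n : ℕ} (z : Fin n → ZMod (2 * q)) (i : Fin n) :
    foldTuple q z (firstHalf i) = z i := by
  simp [foldTuple, firstHalf]

omit [Fintype (ZMod (2 * q))] in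
theorem foldTuple_rev_firstHalf {n : ℕ} (z : Fin n → ZMod (2 * q)) (i : Fin n) :
    foldTuple q z (firstHalf i).rev = q - z i := by
  have h1 : ¬ (((firstHalf i).rev : Fin (2 * n)) : ℕ) < n := by
    simp only [firstHalf, Fin.val_rev]; omega
  rw [foldTuple, dif_neg h1]
  congr 2
  apply Fin.ext
  simp only [firstHalf, Fin.val_rev]; omega

theorem eq_firstHalf_or_rev {n : ℕ} (j : Fin (2 * n)) :
    ∃ i, j = firstHalf i ∨ j = (firstHalf i).rev := by
  by_cases h : (j : ℕ) < n
  · exact ⟨⟨j, h⟩, Or.inl rfl⟩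
  · refine ⟨⟨2 * n - 1 - j, by omega⟩, Or.inr ?_⟩
    apply Fin.ext
    simp only [firstHalf, Fin.val_rev]; omega

theorem firstHalf_ne_rev {n : ℕ} (i j : Fin n) : firstHalf i ≠ (firstHalf j).rev := by
  rw [Ne, Fin.ext_iff]; simp only [firstHalf, Fin.val_rev]; omega

theorem firstHalf_injective {n : ℕ} : Function.Injective (firstHalf (n := n)) := by
  intro i j h
  rw [Fin.ext_iff] at h ⊢
  exact h

/-- Inequivalence up to sign among all entries a and q - a is inequivalence of the first half under
a ↦ ±a, q ± a. Within an opposite pair, a = q - a is what `nonHalves` excludes, and a = -(q - a)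
would give q = 0. Evenness of q lets a and q - a have the same parity. -/
theorem card_foldable (hq : 0 < q) (h : 2 ∣ q) (p : ZMod 2) (n : ℕ) :
    #{y : Fin (2 * n) → ZMod (2 * q) | (∀ i, y i ∈ level q p) ∧
      (∀ i j, i ≠ j → ¬ signSetoid (2 * q) (y i) (y j)) ∧ ∀ i, y i + y i.rev = q} =
      sepCount (kleinSetoid q) (nonHalves q p) n := by
  have hq2 : (q : ZMod 2) = 0 := by rwa [ZMod.natCast_eq_zero_iff]
  have hqq := natCast_add_self q
  have hq0 := natCast_ne_zero hq
  refine card_nbij' (fun y i => y (firstHalf i)) (foldTuple q) ?_ ?_ ?_ ?_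
  · intro y hy
    simp only [coe_filter, mem_univ, true_and, Set.mem_ofPred_eq, nonHalves, mem_filter] at hy ⊢
    obtain ⟨h1, h2, h3⟩ := hy
    refine ⟨fun i => ⟨h1 _, fun e => h2 _ _ (firstHalf_ne_rev i i) (Or.inl ?_)⟩, fun i j hij => ?_⟩
    · linear_combination e - h3 (firstHalf i)
    · have hij' := fun e => hij (firstHalf_injective e)
      rintro (e | e | e | e)
      · exact h2 _ _ hij' (Or.inl e)
      · exact h2 _ _ hij' (Or.inr e)
      · exact h2 _ _ (firstHalf_ne_rev i j)
          (Or.inl (by linear_combination e - h3 (firstHalf j)))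
      · exact h2 _ _ (firstHalf_ne_rev i j)
          (Or.inr (by linear_combination e + h3 (firstHalf j) + hqq))
  · intro z hz
    simp only [coe_filter, mem_univ, true_and, Set.mem_ofPred_eq, nonHalves, mem_filter,
      mem_level] at hz ⊢
    obtain ⟨h1, h2⟩ := hz
    refine ⟨fun j => ?_, fun i j hij => ?_, fun j => ?_⟩
    · obtain ⟨i, rfl | rfl⟩ := eq_firstHalf_or_rev j
      · rw [foldTuple_firstHalf, (h1 i).1]
      · rw [foldTuple_rev_firstHalf, sub_eq_add_neg, map_add, parity_neg, parity_natCast, hq2,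
          (h1 i).1, zero_add]
    · obtain ⟨a, rfl | rfl⟩ := eq_firstHalf_or_rev i <;>
        obtain ⟨b, rfl | rfl⟩ := eq_firstHalf_or_rev j <;>
        simp only [foldTuple_firstHalf, foldTuple_rev_firstHalf]
      · have hab : a ≠ b := fun e => hij (by rw [e])
        rintro (e | e)
        · exact h2 a b hab (Or.inl e)
        · exact h2 a b hab (Or.inr (Or.inl e))
      · rintro (e | e)
        · by_cases hab : a = b
          · subst hab
            exact (h1 a).2 (by linear_combination e)
          · exact h2 a b hab (Or.inr (Or.inr (Or.inl e)))
        · by_cases hab : a = b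
          · subst hab
            exact hq0 (by linear_combination e)
          · exact h2 a b hab (Or.inr (Or.inr (Or.inr (by linear_combination e - hqq))))
      · rintro (e | e)
        · by_cases hab : a = b
          · subst hab
            exact (h1 a).2 (by linear_combination -e)
          · exact h2 a b hab (Or.inr (Or.inr (Or.inl (by linear_combination -e))))
        · by_cases hab : a = b
          · subst hab
            exact hq0 (by linear_combination e)
          · exact h2 a b hab (Or.inr (Or.inr (Or.inr (by linear_combination -e))))
      · have hab : a ≠ b := fun e => hij (by rw [e])
        rintro (e | e)
        · exact h2 a b hab (Or.inl (by linear_combination -e))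
        · exact h2 a b hab (Or.inr (Or.inl (by linear_combination -e + hqq)))
    · obtain ⟨i, rfl | rfl⟩ := eq_firstHalf_or_rev j
      · rw [foldTuple_firstHalf, foldTuple_rev_firstHalf]; ring
      · rw [Fin.rev_rev, foldTuple_firstHalf, foldTuple_rev_firstHalf]; ring
  · intro y hy
    simp only [coe_filter, mem_univ, true_and, Set.mem_ofPred_eq] at hy
    funext j
    obtain ⟨i, rfl | rfl⟩ := eq_firstHalf_or_rev j
    · rw [foldTuple_firstHalf]
    · rw [foldTuple_rev_firstHalf]; linear_combination -hy.2.2 (firstHalf i)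
  · intro z _
    funext i
    exact foldTuple_firstHalf q z i

theorem card_admissible_negRev_of_even (hq : 0 < q) (h : 2 ∣ q) {n : ℕ} (hn : 0 < n) :
    #{y : Fin (2 * n) → ZMod (2 * q) | Admissible q y ∧
      (negRev y = y ∨ negRev y = fun i => y i + q)} =
      sepCount (kleinSetoid q) (nonHalves q 0) n + sepCount (kleinSetoid q) (nonHalves q 1) n := by
  rw [← card_foldable q hq h, ← card_foldable q hq h]
  convert card_equal_parity q (⟨0, by omega⟩ : Fin (2 * n)) fun y =>
    (∀ i j, i ≠ j → ¬ signSetoid (2 * q) (y i) (y j)) ∧ ∀ i, y i + y i.rev = q using 2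
  · ext y
    simp only [mem_filter, mem_univ, true_and, Admissible, and_assoc]
    refine and_congr_right fun _ => and_congr_right fun h2 => ?_
    exact negRev_fixed_iff q hn y h2
  · congr!
  · congr!

end ResidueTuples

/-! ### Longest elements of parabolic subgroups -/

section LongestElements

variable {ι M N : Type*} [AddCommGroup M] [Module ℝ M] [AddCommGroup N] [Module ℝ N]
  {P : RootPairing ι ℝ M N}

theorem ofIdx_mul_self (i : ι) :
    RootPairing.weylGroup.ofIdx P i * RootPairing.weylGroup.ofIdx P i = 1 := by
  apply Subtype.ext
  exact mul_eq_one_iff_eq_inv.2 (RootPairing.Equiv.reflection_inv P i).symm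

theorem ofIdx_inv (i : ι) :
    (RootPairing.weylGroup.ofIdx P i)⁻¹ = RootPairing.weylGroup.ofIdx P i :=
  inv_eq_of_mul_eq_one_left (ofIdx_mul_self i)

theorem ofIdx_smul (i : ι) (m : M) : RootPairing.weylGroup.ofIdx P i • m = P.reflection i m := rfl

theorem weylGroupToPerm_ofIdx (i j : ι) :
    P.weylGroupToPerm (RootPairing.weylGroup.ofIdx P i) j = P.reflectionPerm i j := by
  apply P.root.injective
  rw [← P.weylGroup_apply_root, ofIdx_smul, P.root_reflectionPerm]

theorem weylGroup_ext {v w : P.weylGroup} (h : ∀ m : M, v • m = w • m) : v = w := by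
  apply Subtype.ext
  apply RootPairing.Equiv.weightHom_injective P
  exact LinearEquiv.ext h

/-- The product of the reflections with the given indices. -/
def word (P : RootPairing ι ℝ M N) (L : List ι) : P.weylGroup :=
  (L.map (RootPairing.weylGroup.ofIdx P)).prod

theorem word_cons (i : ι) (L : List ι) :
    word P (i :: L) = RootPairing.weylGroup.ofIdx P i * word P L := by
  simp [word]

theorem word_append (L L' : List ι) : word P (L ++ L') = word P L * word P L' := by
  simp [word]

/-- Conjugating a reflection by w gives the reflection in the image root. -/
theorem word_mul_ofIdx (L : List ι) (j : ι) :
    word P L * RootPairing.weylGroup.ofIdx P j =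
      RootPairing.weylGroup.ofIdx P (P.weylGroupToPerm (word P L) j) * word P L := by
  induction L with
  | nil => simp [word]
  | cons i L ih =>
    have h : RootPairing.weylGroup.ofIdx P (P.reflectionPerm i (P.weylGroupToPerm (word P L) j)) =
        RootPairing.weylGroup.ofIdx P i *
          RootPairing.weylGroup.ofIdx P (P.weylGroupToPerm (word P L) j) *
          RootPairing.weylGroup.ofIdx P i := by
      refine weylGroup_ext fun m => ?_
      simp only [mul_smul, ofIdx_smul, RootPairing.reflection_reflectionPerm]
      rfl
    rw [word_cons, map_mul, Equiv.Perm.mul_apply, weylGroupToPerm_ofIdx, h, mul_assoc, ih]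
    simp only [mul_assoc]
    rw [← mul_assoc (RootPairing.weylGroup.ofIdx P i) (RootPairing.weylGroup.ofIdx P i),
      ofIdx_mul_self, one_mul]

theorem exists_word_of_mem_closure {K : Set ι} {w : P.weylGroup}
    (hw : w ∈ Subgroup.closure (simpleReflections P K)) :
    ∃ L : List ι, (∀ i ∈ L, i ∈ K) ∧ word P L = w := by
  induction hw using Subgroup.closure_induction with
  | mem x hx =>
    obtain ⟨i, hi, rfl⟩ := hx
    exact ⟨[i], by simpa using hi, by simp [word]⟩
  | one => exact ⟨[], by simp, by simp [word]⟩
  | mul x y _ _ hx hy =>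
    obtain ⟨L, hL, rfl⟩ := hx
    obtain ⟨L', hL', rfl⟩ := hy
    refine ⟨L ++ L', fun i hi => ?_, word_append L L'⟩
    rcases List.mem_append.1 hi with h | h
    exacts [hL i h, hL' i h]
  | inv x _ hx =>
    obtain ⟨L, hL, rfl⟩ := hx
    refine ⟨L.reverse, by simpa using hL, ?_⟩
    rw [word, word, List.prod_inv_reverse, List.map_reverse, List.map_map]
    congr 3
    funext i
    exact (ofIdx_inv i).symm

theorem wordLength_word_le {K : Set ι} {L : List ι} (hL : ∀ i ∈ L, i ∈ K) :
    wordLength (simpleReflections P K) (word P L) ≤ L.length := by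
  refine Nat.sInf_le ⟨L.map (RootPairing.weylGroup.ofIdx P), ?_, by simp, rfl⟩
  intro s hs
  obtain ⟨i, hi, rfl⟩ := List.mem_map.1 hs
  exact ⟨i, hL i hi, rfl⟩

theorem exists_reduced_word {K : Set ι} {w : P.weylGroup}
    (hw : w ∈ Subgroup.closure (simpleReflections P K)) :
    ∃ L : List ι, (∀ i ∈ L, i ∈ K) ∧ word P L = w ∧
      L.length = wordLength (simpleReflections P K) w := by
  have hne : {n | ∃ L : List P.weylGroup, (∀ s ∈ L, s ∈ simpleReflections P K) ∧
      L.length = n ∧ L.prod = w}.Nonempty := by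
    obtain ⟨L, hL, rfl⟩ := exists_word_of_mem_closure hw
    refine ⟨L.length, L.map (RootPairing.weylGroup.ofIdx P), ?_, by simp, rfl⟩
    intro s hs
    obtain ⟨i, hi, rfl⟩ := List.mem_map.1 hs
    exact ⟨i, hL i hi, rfl⟩
  obtain ⟨L, hL, hlen, rfl⟩ := Nat.sInf_mem hne
  have : ∀ L : List P.weylGroup, (∀ s ∈ L, s ∈ simpleReflections P K) →
      ∃ L' : List ι, (∀ i ∈ L', i ∈ K) ∧ L'.map (RootPairing.weylGroup.ofIdx P) = L := by
    intro L hL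
    induction L with
    | nil => exact ⟨[], by simp, rfl⟩
    | cons s L ih =>
      obtain ⟨L', hL', rfl⟩ := ih fun t ht => hL t (List.mem_cons_of_mem _ ht)
      obtain ⟨i, hi, rfl⟩ := hL s List.mem_cons_self
      exact ⟨i :: L', by simpa using ⟨hi, hL'⟩, rfl⟩
  obtain ⟨L', hL', rfl⟩ := this L hL
  exact ⟨L', hL', rfl, by rw [← List.length_map, hlen]; rfl⟩

variable [Finite ι] [P.IsCrystallographic] [P.IsReduced] (b : P.Base)

/-- The exchange condition. -/
theorem exists_word_of_not_isPos {K : Set ι} (hK : K ⊆ b.support) {j : ι} (hj : j ∈ b.support)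
    (L : List ι) (hL : ∀ i ∈ L, i ∈ K) (h : ¬ b.IsPos (P.weylGroupToPerm (word P L) j)) :
    ∃ L' : List ι, (∀ i ∈ L', i ∈ K) ∧ L'.length + 1 = L.length ∧
      word P L * RootPairing.weylGroup.ofIdx P j = word P L' := by
  induction L with
  | nil => exact absurd (b.isPos_of_mem_support hj) (by simpa [word] using h)
  | cons i L ih =>
    have hL' : ∀ i ∈ L, i ∈ K := fun k hk => hL k (List.mem_cons_of_mem _ hk)
    have hi : i ∈ K := hL i List.mem_cons_self
    by_cases hp : b.IsPos (P.weylGroupToPerm (word P L) j)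
    -- A simple reflection makes no positive root negative except its own. Prepending i changes the
    -- sign, so the image root is that of i, and the letter i cancels.
    · have heq : P.weylGroupToPerm (word P L) j = i := by
        by_contra hne
        refine h ?_
        rw [word_cons, map_mul, Equiv.Perm.mul_apply, weylGroupToPerm_ofIdx]
        exact hp.reflectionPerm (hK hi) hne
      refine ⟨L, hL', rfl, ?_⟩
      rw [word_cons, mul_assoc, word_mul_ofIdx, heq, ← mul_assoc, ofIdx_mul_self, one_mul]
    · obtain ⟨L', h1, h2, h3⟩ := ih hL' hp
      refine ⟨i :: L', ?_, by simp [h2], by rw [word_cons, word_cons, mul_assoc, h3]⟩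
      intro k hk
      rcases List.mem_cons.1 hk with rfl | hk
      exacts [hi, h1 k hk]

omit [Finite ι] [P.IsCrystallographic] [P.IsReduced] in
theorem not_isPos_reflectionPerm_self {i : ι} (h : b.IsPos i) :
    ¬ b.IsPos (P.reflectionPerm i i) := by
  have := (RootPairing.Base.IsPos.neg_iff_not b i).not
  rw [not_not] at this
  exact this.2 h

/-- A longest element of a parabolic subgroup sends its simple roots to negative roots. -/
theorem IsLongest.not_isPos {K : Set ι} (hK : K ⊆ b.support) {w : P.weylGroup}
    (hw : IsLongest (simpleReflections P K) w) {j : ι} (hj : j ∈ K) :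
    ¬ b.IsPos (P.weylGroupToPerm w j) := by
  intro hpos
  have hmem : w * RootPairing.weylGroup.ofIdx P j ∈ Subgroup.closure (simpleReflections P K) :=
    mul_mem hw.1 (Subgroup.subset_closure ⟨j, hj, rfl⟩)
  -- If w kept the root of j positive, then w s_j would make it negative; by exchange, w = (w s_j)
  -- s_j would be shorter than w s_j, against maximality.
  obtain ⟨L, hL, hprod, hlen⟩ := exists_reduced_word hmem
  have hneg : ¬ b.IsPos (P.weylGroupToPerm (word P L) j) := by
    rw [hprod, map_mul, Equiv.Perm.mul_apply, weylGroupToPerm_ofIdx]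
    have : P.weylGroupToPerm w (P.reflectionPerm j j) =
        P.reflectionPerm (P.weylGroupToPerm w j) (P.weylGroupToPerm w j) := by
      apply P.root.injective
      rw [← P.weylGroup_apply_root, P.root_reflectionPerm, P.root_reflectionPerm,
        P.reflection_apply_self, P.reflection_apply_self, smul_neg, P.weylGroup_apply_root]
    rw [this]
    exact not_isPos_reflectionPerm_self b hpos
  obtain ⟨L', h1, h2, h3⟩ := exists_word_of_not_isPos b hK (hK hj) L hL hneg
  rw [hprod, mul_assoc, ofIdx_mul_self, mul_one] at h3
  have h4 := wordLength_word_le (P := P) h1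
  have h5 := hw.2 _ hmem
  rw [← h3] at h4
  omega

/-- An element of a parabolic subgroup that keeps its simple roots positive is trivial. -/
theorem eq_one_of_isPos {K : Set ι} (hK : K ⊆ b.support) {w : P.weylGroup}
    (hw : w ∈ Subgroup.closure (simpleReflections P K))
    (h : ∀ j ∈ K, b.IsPos (P.weylGroupToPerm w j)) : w = 1 := by
  obtain ⟨L, hL, rfl, hlen⟩ := exists_reduced_word hw
  rcases List.eq_nil_or_concat' L with rfl | ⟨L, j, rfl⟩
  · simp [word]
  exfalso
  have hj : j ∈ K := hL j (by simp)
  have hL' : ∀ i ∈ L, i ∈ K := fun i hi => hL i (by simp [hi])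
  have hw' : word P (L ++ [j]) = word P L * RootPairing.weylGroup.ofIdx P j := by
    rw [word_append]; simp [word]
  -- The last letter j of a reduced word must be a root made positive by the rest, since the whole
  -- word reverses its sign; otherwise the word could be shortened.
  have hneg : ¬ b.IsPos (P.weylGroupToPerm (word P L) j) := by
    intro hpos
    have := h j hj
    rw [hw', word_mul_ofIdx, map_mul, Equiv.Perm.mul_apply, weylGroupToPerm_ofIdx] at this
    exact not_isPos_reflectionPerm_self b hpos this
  obtain ⟨L', h1, h2, h3⟩ := exists_word_of_not_isPos b hK (hK hj) L hL' hneg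
  rw [hw', h3] at hlen
  have := wordLength_word_le (P := P) h1
  simp at hlen
  omega

/-- Recognition of the longest element: an element of a parabolic subgroup that sends the simple
roots of that subgroup to the negatives of its simple roots is inverse to the longest element. -/
theorem longestElement_eq_inv [P.IsRootSystem] {K : Set ι} (hK : K ⊆ b.support) {u : P.weylGroup}
    (hu : u ∈ Subgroup.closure (simpleReflections P K))
    (h : ∀ j ∈ K, ∃ k ∈ K, u • P.root j = -P.root k) :
    longestElement (simpleReflections P K) = u⁻¹ := by
  have hw : IsLongest (simpleReflections P K) (longestElement (simpleReflections P K)) :=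
    Classical.choose_spec (exists_isLongest _)
  rw [eq_inv_iff_mul_eq_one]
  refine eq_one_of_isPos b hK (mul_mem hw.1 hu) fun j hj => ?_
  obtain ⟨k, hk, hjk⟩ := h j hj
  have hneg := hw.not_isPos b hK hk
  have : P.weylGroupToPerm (longestElement (simpleReflections P K) * u) j =
      P.reflectionPerm (P.weylGroupToPerm (longestElement (simpleReflections P K)) k)
        (P.weylGroupToPerm (longestElement (simpleReflections P K)) k) := by
    apply P.root.injective
    rw [← P.weylGroup_apply_root, mul_smul, hjk, P.root_reflectionPerm, P.reflection_apply_self,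
      smul_neg, P.weylGroup_apply_root]
  rw [this]
  exact (RootPairing.Base.IsPos.neg_iff_not b _).2 hneg

end LongestElements

/-! ### Orthogonal coordinates for root systems of type `D` -/

section FrameD

variable {ι M N : Type*} [AddCommGroup M] [Module ℝ M] [AddCommGroup N] [Module ℝ N]

/-- The vectors `β` are expressed through the vectors `e` as are the simple roots of type `D_ℓ`
through the standard basis. -/
structure IsFrameD {ℓ : ℕ} (β e : Fin ℓ → M) : Prop where
  chain : ∀ i j : Fin ℓ, (i : ℕ) + 1 = j → β i = e i - e j
  last : ∀ i j : Fin ℓ, (i : ℕ) + 2 = ℓ → (j : ℕ) + 1 = ℓ → β j = e i + e j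

theorem exists_isFrameD {ℓ : ℕ} (hℓ : 4 ≤ ℓ) (β : Fin ℓ → M) : ∃ e : Fin ℓ → M, IsFrameD β e := by
  let B : ℕ → M := fun k => if h : k < ℓ then β ⟨k, h⟩ else 0
  have hB : ∀ i : Fin ℓ, B i = β i := fun i => dif_pos i.2
  -- Solving from the end: the last vector is half the difference of the two simple roots at the
  -- fork, and each earlier one adds the next simple root of the chain.
  let E : ℕ → M := fun i =>
    ∑ k ∈ Finset.Ico i (ℓ - 1), B k + (1 / 2 : ℝ) • (B (ℓ - 1) - B (ℓ - 2))
  have hE : ∀ i, i + 1 < ℓ → E i = B i + E (i + 1) := fun i hi => by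
    simp only [E]
    rw [Finset.sum_eq_sum_Ico_succ_bot (by omega), add_assoc]
  have hlast : E (ℓ - 1) = (1 / 2 : ℝ) • (B (ℓ - 1) - B (ℓ - 2)) := by simp [E]
  refine ⟨fun i => E i, ⟨fun i j hij => ?_, fun i j hi hj => ?_⟩⟩
  · rw [← hB, hE i (by omega), hij]; abel
  · have hi' : (i : ℕ) = ℓ - 2 := by omega
    have hj' : (j : ℕ) = ℓ - 1 := by omega
    rw [← hB]
    simp only [hi', hj']
    rw [hE (ℓ - 2) (by omega), show ℓ - 2 + 1 = ℓ - 1 by omega, hlast]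
    module

/-- The last two relations force the last entry to vanish, and the chain carries this back to the
others. Identities on the frame can therefore be checked on simple roots. -/
theorem eq_zero_of_chain {ℓ : ℕ} (hℓ : 4 ≤ ℓ) (h : Fin ℓ → ℝ)
    (h1 : ∀ i j : Fin ℓ, (i : ℕ) + 1 = j → h i - h j = 0)
    (h2 : ∀ i j : Fin ℓ, (i : ℕ) + 2 = ℓ → (j : ℕ) + 1 = ℓ → h i + h j = 0) (i : Fin ℓ) :
    h i = 0 := by
  have key : ∀ d : ℕ, ∀ i : Fin ℓ, (i : ℕ) + 1 + d = ℓ → h i = 0 := by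
    intro d
    induction d with
    | zero =>
      intro i hi
      have a := h1 ⟨ℓ - 2, by omega⟩ i (by simp only; omega)
      have b := h2 ⟨ℓ - 2, by omega⟩ i (by simp only; omega) (by omega)
      linarith
    | succ d ih =>
      intro i hi
      have a := h1 i ⟨i + 1, by omega⟩ rfl
      have b := ih ⟨i + 1, by omega⟩ (by simp only; omega)
      linarith
  exact key (ℓ - 1 - i) i (by omega)

theorem val_swap {ℓ : ℕ} (k k' i : Fin ℓ) : ((Equiv.swap k k' i : Fin ℓ) : ℕ) =
    if (i : ℕ) = k then (k' : ℕ) else if (i : ℕ) = k' then (k : ℕ) else i := by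
  rw [Equiv.swap_apply_def]
  simp only [Fin.ext_iff]
  split_ifs <;> rfl

variable {P : RootPairing ι ℝ M N} [P.IsCrystallographic] {b : P.Base} {ℓ : ℕ}
  {α : Fin ℓ ≃ b.support}

/-- The simple roots, in the order of the labelling. -/
def simpleRoot (α : Fin ℓ ≃ b.support) (k : Fin ℓ) : M := P.root (α k)

/-- The simple reflections, in the order of the labelling. -/
def simpleRefl (α : Fin ℓ ≃ b.support) (k : Fin ℓ) : P.weylGroup :=
  RootPairing.weylGroup.ofIdx P (α k)

omit [P.IsCrystallographic] in
theorem simpleRefl_smul (k : Fin ℓ) (m : M) :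
    simpleRefl α k • m = m - P.coroot' (α k) m • simpleRoot α k :=
  P.reflection_apply _ _

theorem coroot'_simpleRoot (hD : IsLabellingD b ℓ α) (i k : Fin ℓ) :
    P.coroot' (α k) (simpleRoot α i) = (CartanMatrix.D ℓ i k : ℝ) := by
  rw [← hD i k, simpleRoot, RootPairing.root_coroot'_eq_pairing]
  exact (P.algebraMap_pairingIn ℤ _ _).symm

/-- Both sides have the same differences along the chain and the same sum at the fork, namely the
entries of the Cartan matrix. -/
theorem coroot'_frame (hℓ : 4 ≤ ℓ) (hD : IsLabellingD b ℓ α) {e : Fin ℓ → M}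
    (he : IsFrameD (simpleRoot α) e) (k i : Fin ℓ) :
    P.coroot' (α k) (e i) = if (k : ℕ) + 1 < ℓ then
      (if i = k then 1 else if (i : ℕ) = k + 1 then -1 else 0)
      else (if ℓ ≤ (i : ℕ) + 2 then 1 else 0) := by
  refine sub_eq_zero.1 (eq_zero_of_chain hℓ (fun i => P.coroot' (α k) (e i) -
    if (k : ℕ) + 1 < ℓ then
      (if i = k then 1 else if (i : ℕ) = k + 1 then -1 else 0)
      else (if ℓ ≤ (i : ℕ) + 2 then 1 else 0)) ?_ ?_ i)
  · intro i j hij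
    have h := coroot'_simpleRoot hD i k
    rw [he.chain i j hij, map_sub] at h
    rw [sub_sub_sub_comm, h]
    simp only [CartanMatrix.D, Matrix.of_apply, Fin.ext_iff]
    have := i.2; have := j.2; have := k.2
    split_ifs <;> first | omega | norm_num
  · intro i j hi hj
    have h := coroot'_simpleRoot hD j k
    rw [he.last i j hi hj, map_add] at h
    rw [← add_sub_add_comm, h]
    simp only [CartanMatrix.D, Matrix.of_apply, Fin.ext_iff]
    have := i.2; have := j.2; have := k.2
    split_ifs <;> first | omega | norm_num

variable (hℓ : 4 ≤ ℓ) (hD : IsLabellingD b ℓ α) {e : Fin ℓ → M}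
  (he : IsFrameD (simpleRoot α) e)

include hℓ hD he

theorem simpleRefl_smul_frame_of_lt {k k' : Fin ℓ} (hk : (k : ℕ) + 1 = k') (i : Fin ℓ) :
    simpleRefl α k • e i = e (Equiv.swap k k' i) := by
  have hkk : k ≠ k' := by rw [Ne, Fin.ext_iff]; omega
  rw [simpleRefl_smul, coroot'_frame hℓ hD he, if_pos (by omega), he.chain k k' hk]
  by_cases h1 : i = k
  · subst h1; simp
  · by_cases h2 : i = k'
    · subst h2
      rw [if_neg h1, if_pos hk.symm, Equiv.swap_apply_right]
      simp
    · rw [if_neg h1, if_neg (by rw [Fin.ext_iff] at h2; omega), Equiv.swap_apply_of_ne_of_ne h1 h2]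
      simp

theorem simpleRefl_smul_frame_of_last {k k' : Fin ℓ} (hk : (k : ℕ) + 2 = ℓ) (hk' : (k' : ℕ) + 1 = ℓ)
    (i : Fin ℓ) : simpleRefl α k' • e i =
      (if i = k ∨ i = k' then (-1 : ℤ) else 1) • e (Equiv.swap k k' i) := by
  have hkk : k ≠ k' := by rw [Ne, Fin.ext_iff]; omega
  rw [simpleRefl_smul, coroot'_frame hℓ hD he, if_neg (by omega), he.last k k' hk hk']
  by_cases h1 : i = k
  · subst h1; rw [if_pos (by omega), if_pos (Or.inl rfl)]; simp
  · by_cases h2 : i = k'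
    · subst h2
      rw [if_pos (by omega), if_pos (Or.inr rfl), Equiv.swap_apply_right]
      simp
    · rw [if_neg (by rw [Fin.ext_iff] at h1 h2; omega), if_neg (by tauto),
        Equiv.swap_apply_of_ne_of_ne h1 h2]
      simp

theorem exists_signedPerm_simpleRefl (k : Fin ℓ) : ∃ (σ : Equiv.Perm (Fin ℓ)) (ε : Fin ℓ → ℤ),
    (∀ i, ε i = 1 ∨ ε i = -1) ∧ ∀ i, simpleRefl α k • e i = ε i • e (σ i) := by
  by_cases hk : (k : ℕ) + 1 < ℓ
  · refine ⟨Equiv.swap k ⟨k + 1, hk⟩, fun _ => 1, fun _ => Or.inl rfl, fun i => ?_⟩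
    rw [simpleRefl_smul_frame_of_lt hℓ hD he (k' := ⟨k + 1, hk⟩) rfl, one_smul]
  · refine ⟨Equiv.swap ⟨ℓ - 2, by omega⟩ k, _, fun i => ?_,
      simpleRefl_smul_frame_of_last hℓ hD he (k := ⟨ℓ - 2, by omega⟩)
        (by simp only; omega) (by omega)⟩
    split_ifs <;> simp

/-- Permutations of the frame are realized in the subgroup generated by the first `ℓ - 1` simple
reflections. -/
theorem exists_perm_smul {H : Subgroup P.weylGroup}
    (hH : ∀ k : Fin ℓ, (k : ℕ) + 1 < ℓ → simpleRefl α k ∈ H) (σ : Equiv.Perm (Fin ℓ)) :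
    ∃ w ∈ H, ∀ i, w • e i = e (σ i) := by
  obtain ⟨n, rfl⟩ : ∃ n, ℓ = n + 1 := ⟨ℓ - 1, by omega⟩
  have hσ : σ ∈ Submonoid.closure (Set.range fun i : Fin n => Equiv.swap i.castSucc i.succ) := by
    rw [Equiv.Perm.mclosure_swap_castSucc_succ]; trivial
  induction hσ using Submonoid.closure_induction with
  | mem x hx =>
    obtain ⟨i, rfl⟩ := hx
    exact ⟨simpleRefl α i.castSucc, hH _ (by simp), fun j =>
      simpleRefl_smul_frame_of_lt hℓ hD he (by simp) j⟩
  | one => exact ⟨1, one_mem _, fun i => by simp⟩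
  | mul x y _ _ hx hy =>
    obtain ⟨v, hv, hv'⟩ := hx
    obtain ⟨w, hw, hw'⟩ := hy
    exact ⟨v * w, mul_mem hv hw, fun i => by rw [mul_smul, hw', hv']; rfl⟩

omit [P.IsCrystallographic] hℓ hD he in
/-- Diagonal sign changes realized in a subgroup of the Weyl group. -/
theorem exists_smul_mul {H : Subgroup P.weylGroup} {ε ε' : Fin ℓ → ℤ}
    (h : ∃ w ∈ H, ∀ i, w • e i = ε i • e i) (h' : ∃ w ∈ H, ∀ i, w • e i = ε' i • e i) :
    ∃ w ∈ H, ∀ i, w • e i = (ε i * ε' i) • e i := by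
  obtain ⟨v, hv, hv'⟩ := h
  obtain ⟨w, hw, hw'⟩ := h'
  refine ⟨v * w, mul_mem hv hw, fun i => ?_⟩
  rw [mul_smul, hw', smul_comm, hv', smul_smul, mul_comm]

/-- Conjugating a diagonal sign change by a transposition permutes its signs. -/
theorem exists_smul_swap {H : Subgroup P.weylGroup} {ε : Fin ℓ → ℤ}
    (h : ∃ w ∈ H, ∀ i, w • e i = ε i • e i) {k k' : Fin ℓ} (hk : (k : ℕ) + 1 = k')
    (hH : simpleRefl α k ∈ H) :
    ∃ w ∈ H, ∀ i, w • e i = ε (Equiv.swap k k' i) • e i := by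
  obtain ⟨v, hv, hv'⟩ := h
  refine ⟨simpleRefl α k * v * simpleRefl α k, mul_mem (mul_mem hH hv) hH, fun i => ?_⟩
  rw [mul_smul, mul_smul, simpleRefl_smul_frame_of_lt hℓ hD he hk, hv', smul_comm,
    simpleRefl_smul_frame_of_lt hℓ hD he hk, Equiv.swap_apply_self]

/-- The sign change of two neighbouring frame vectors. -/
theorem exists_neg_pair {H : Subgroup P.weylGroup} {lo : ℕ}
    (hH : ∀ k : Fin ℓ, lo ≤ k → simpleRefl α k ∈ H) (a : ℕ) (ha : lo ≤ a) (ha' : a + 1 < ℓ) :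
    ∃ w ∈ H, ∀ i : Fin ℓ,
      w • e i = (if (i : ℕ) = a ∨ (i : ℕ) = a + 1 then (-1 : ℤ) else 1) • e i := by
  have key : ∀ d a : ℕ, lo ≤ a → a + 2 + d = ℓ → ∃ w ∈ H, ∀ i : Fin ℓ,
      w • e i = (if (i : ℕ) = a ∨ (i : ℕ) = a + 1 then (-1 : ℤ) else 1) • e i := by
    intro d
    induction d with
    | zero =>
      intro a ha had
      let k : Fin ℓ := ⟨a, by omega⟩
      let k' : Fin ℓ := ⟨a + 1, by omega⟩
      -- The two reflections at the fork induce the same transposition and differ by the signs of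
      -- the last two vectors.
      refine ⟨simpleRefl α k * simpleRefl α k', mul_mem (hH _ ha) (hH _ (by simp [k']; omega)),
        fun i => ?_⟩
      rw [mul_smul, simpleRefl_smul_frame_of_last hℓ hD he (k := k) had (by simp [k']; omega),
        smul_comm, simpleRefl_smul_frame_of_lt hℓ hD he (k' := k') rfl, Equiv.swap_apply_self]
      simp [Fin.ext_iff, k, k']
    | succ d ih =>
      intro a ha had
      -- The negated pair moves from {a+1, a+2} to {a, a+2} and then to {a, a+1}.
      have h0 := ih (a + 1) (by omega) (by omega)
      have h1 := exists_smul_swap hℓ hD he h0 (k := ⟨a, by omega⟩) (k' := ⟨a + 1, by omega⟩) rfl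
        (hH _ ha)
      have h2 := exists_smul_swap hℓ hD he (ε := fun i => _) h1 (k := ⟨a + 1, by omega⟩)
        (k' := ⟨a + 2, by omega⟩) rfl (hH _ (by simp; omega))
      obtain ⟨w, hw, hw'⟩ := h2
      refine ⟨w, hw, fun i => ?_⟩
      rw [hw']
      congr 1
      simp only [val_swap]
      split_ifs <;> first | rfl | omega
  exact key (ℓ - 2 - a) a ha (by omega)

/-- The sign change of an even number of consecutive frame vectors. -/
theorem exists_neg_interval {H : Subgroup P.weylGroup} {lo : ℕ}
    (hH : ∀ k : Fin ℓ, lo ≤ k → simpleRefl α k ∈ H) (m : ℕ) (hm : lo + 2 * m ≤ ℓ) :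
    ∃ w ∈ H, ∀ i : Fin ℓ,
      w • e i = (if lo ≤ (i : ℕ) ∧ (i : ℕ) < lo + 2 * m then (-1 : ℤ) else 1) • e i := by
  induction m with
  | zero => exact ⟨1, one_mem _, fun i => by rw [if_neg (by omega)]; simp⟩
  | succ m ih =>
    obtain ⟨w, hw, hw'⟩ := exists_smul_mul (ih (by omega))
      (exists_neg_pair hℓ hD he hH (lo + 2 * m) (by omega) (by omega))
    refine ⟨w, hw, fun i => ?_⟩
    rw [hw']
    congr 1
    split_ifs <;> omega

end FrameD

section TypeD

variable {ι M N : Type*} [AddCommGroup M] [Module ℝ M] [AddCommGroup N] [Module ℝ N]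
  {P : RootPairing ι ℝ M N} [P.IsCrystallographic] {b : P.Base} {ℓ : ℕ}
  {α : Fin ℓ ≃ b.support} (hℓ : 4 ≤ ℓ) (hD : IsLabellingD b ℓ α) {e : Fin ℓ → M}
  (he : IsFrameD (simpleRoot α) e)

/-! ### The roots in orthogonal coordinates -/

/-- Double transitivity: it carries one simple root to every `e i - e j`, and the last one to every
`e i + e j`. -/
theorem exists_perm_apply_eq {A : Type*} [DecidableEq A] {a a' i j : A} (ha : a ≠ a')
    (hij : i ≠ j) : ∃ σ : Equiv.Perm A, σ a = i ∧ σ a' = j := by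
  have h : Equiv.swap a i a' ≠ i := by
    intro h
    exact ha ((Equiv.swap a i).injective (h.trans (Equiv.swap_apply_left a i).symm)).symm
  refine ⟨Equiv.swap (Equiv.swap a i a') j * Equiv.swap a i, ?_, ?_⟩
  · rw [Equiv.Perm.mul_apply, Equiv.swap_apply_left, Equiv.swap_apply_of_ne_of_ne h.symm hij]
  · rw [Equiv.Perm.mul_apply, Equiv.swap_apply_left]

include hℓ hD he in
theorem exists_root_eq_sub {i j : Fin ℓ} (hij : i ≠ j) : ∃ r, P.root r = e i - e j := by
  obtain ⟨σ, h0, h1⟩ := exists_perm_apply_eq (a := (⟨0, by omega⟩ : Fin ℓ)) (a' := ⟨1, by omega⟩)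
    (by simp) hij
  obtain ⟨w, -, hw⟩ := exists_perm_smul hℓ hD he (H := ⊤) (fun _ _ => trivial) σ
  refine ⟨P.weylGroupToPerm w (α ⟨0, by omega⟩), ?_⟩
  rw [← P.weylGroup_apply_root]
  change w • simpleRoot α _ = _
  rw [he.chain _ ⟨1, by omega⟩ rfl, smul_sub, hw, hw, h0, h1]

include hℓ hD he in
theorem exists_root_eq_add {i j : Fin ℓ} (hij : i ≠ j) : ∃ r, P.root r = e i + e j := by
  obtain ⟨σ, h0, h1⟩ := exists_perm_apply_eq (a := (⟨ℓ - 2, by omega⟩ : Fin ℓ))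
    (a' := ⟨ℓ - 1, by omega⟩) (by rw [Ne, Fin.ext_iff]; simp only; omega) hij
  obtain ⟨w, -, hw⟩ := exists_perm_smul hℓ hD he (H := ⊤) (fun _ _ => trivial) σ
  refine ⟨P.weylGroupToPerm w (α ⟨ℓ - 1, by omega⟩), ?_⟩
  rw [← P.weylGroup_apply_root]
  change w • simpleRoot α _ = _
  rw [he.last ⟨ℓ - 2, by omega⟩ ⟨ℓ - 1, by omega⟩ (by simp only; omega) (by simp only; omega),
    smul_add, hw, hw, h0, h1]

include hℓ hD he in
-- Simple roots have this shape, and simple reflections preserve it because they act on the frame by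
-- signed permutations.
theorem exists_root_eq [Finite ι] [P.IsReduced] (r : ι) :
    ∃ i j : Fin ℓ, i ≠ j ∧ ∃ s t : ℤ, (s = 1 ∨ s = -1) ∧ (t = 1 ∨ t = -1) ∧
      P.root r = s • e i + t • e j := by
  refine b.induction_reflect r (p := fun r => ∃ i j : Fin ℓ, i ≠ j ∧ ∃ s t : ℤ,
    (s = 1 ∨ s = -1) ∧ (t = 1 ∨ t = -1) ∧ P.root r = s • e i + t • e j) ?_ ?_ ?_
  · rintro r ⟨i, j, hij, s, t, hs, ht, h⟩
    refine ⟨i, j, hij, -s, -t, by omega, by omega, ?_⟩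
    rw [P.root_reflectionPerm, P.reflection_apply_self, h]
    module
  · intro r hr
    obtain ⟨k, hk⟩ := α.surjective ⟨r, hr⟩
    have hroot : P.root r = simpleRoot α k := by rw [simpleRoot, hk]
    by_cases hkl : (k : ℕ) + 1 < ℓ
    · refine ⟨k, ⟨k + 1, hkl⟩, by simp [Fin.ext_iff], 1, -1, by simp, by simp, ?_⟩
      rw [hroot, he.chain k ⟨k + 1, hkl⟩ rfl]; module
    · refine ⟨⟨ℓ - 2, by omega⟩, k, by rw [Ne, Fin.ext_iff]; simp only; omega, 1, 1, by simp,
        by simp, ?_⟩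
      rw [hroot, he.last ⟨ℓ - 2, by omega⟩ k (by simp only; omega) (by omega)]; module
  · rintro r m ⟨i, j, hij, s, t, hs, ht, h⟩ hm
    obtain ⟨k, hk⟩ := α.surjective ⟨m, hm⟩
    obtain ⟨σ, ε, hε, hσ⟩ := exists_signedPerm_simpleRefl hℓ hD he k
    refine ⟨σ i, σ j, σ.injective.ne hij, s * ε i, t * ε j, ?_, ?_, ?_⟩
    · rcases hs with rfl | rfl <;> rcases hε i with h | h <;> simp [h]
    · rcases ht with rfl | rfl <;> rcases hε j with h | h <;> simp [h]
    · have : P.root (P.reflectionPerm m r) = simpleRefl α k • P.root r := by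
        rw [P.root_reflectionPerm, simpleRefl, ofIdx_smul, hk]
      rw [this, h, smul_add, smul_comm, hσ, smul_comm _ t, hσ, smul_smul, smul_smul]

/-! ### The elements `ω_j` in orthogonal coordinates -/

section Omega

variable [Finite ι] [P.IsRootSystem] [P.IsReduced]

omit [P.IsCrystallographic] [Finite ι] [P.IsRootSystem] [P.IsReduced] in
theorem simpleRefl_mem_closure {K : Set ι} {k : Fin ℓ} (hk : (α k : ι) ∈ K) :
    simpleRefl α k ∈ Subgroup.closure (simpleReflections P K) :=
  Subgroup.subset_closure ⟨α k, hk, rfl⟩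

omit [P.IsCrystallographic] [Finite ι] [P.IsRootSystem] [P.IsReduced] in
theorem coe_mem_diff_iff {j k : Fin ℓ} :
    (α k : ι) ∈ (b.support : Set ι) \ {(α j : ι)} ↔ k ≠ j := by
  simp

include hℓ hD he in
-- As ℓ is even, -1 is an even sign change, hence lies in the Weyl group; it negates every simple
-- root.
theorem longestElement_inv_smul (hev : Even ℓ) (i : Fin ℓ) :
    (longestElement (simpleReflections P (b.support : Set ι)))⁻¹ • e i = -e i := by
  obtain ⟨m, hm⟩ := hev
  obtain ⟨u, hu, hu'⟩ := exists_neg_interval hℓ hD he (lo := 0)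
    (H := Subgroup.closure (simpleReflections P (b.support : Set ι)))
    (fun k _ => simpleRefl_mem_closure (α k).2) m (by omega)
  have hneg : ∀ i, u • e i = -e i := fun i => by
    rw [hu', if_pos (by have := i.2; omega), neg_one_zsmul]
  rw [longestElement_eq_inv b subset_rfl hu, inv_inv, hneg]
  intro r hr
  obtain ⟨k, hk⟩ := α.surjective ⟨r, hr⟩
  have hroot : P.root r = simpleRoot α k := by rw [simpleRoot, hk]
  refine ⟨r, hr, ?_⟩
  rw [hroot]
  by_cases hkl : (k : ℕ) + 1 < ℓ
  · rw [he.chain k ⟨k + 1, hkl⟩ rfl, smul_sub, hneg, hneg]; abel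
  · rw [he.last ⟨ℓ - 2, by omega⟩ k (by simp only; omega) (by omega), smul_add, hneg, hneg]; abel

include hℓ hD he in
-- The inverse is computed because the action on coweights is contragredient.
theorem omega_first_inv_smul (hev : Even ℓ) {j : Fin ℓ} (hj : (j : ℕ) = 0) (i : Fin ℓ) :
    (omega b (α j : ι))⁻¹ • e i =
      (if (i : ℕ) = 0 ∨ (i : ℕ) = ℓ - 1 then (-1 : ℤ) else 1) • e i := by
  obtain ⟨m, hm⟩ := id hev
  -- The m - 1 negated pairs fill positions 1 to ℓ - 2, so both ends keep their signs.
  obtain ⟨u, hu, hu'⟩ := exists_neg_interval hℓ hD he (lo := 1)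
    (H := Subgroup.closure (simpleReflections P
      ((b.support : Set ι) \ {(α j : ι)})))
    (fun k hk => simpleRefl_mem_closure (coe_mem_diff_iff.2 fun h => by rw [h] at hk; omega))
    (m - 1) (by omega)
  have hneg : ∀ i : Fin ℓ, (i : ℕ) ≠ 0 → (i : ℕ) ≠ ℓ - 1 → u • e i = -e i := fun i h h' => by
    rw [hu', if_pos (by have := i.2; omega), neg_one_zsmul]
  have hpos : ∀ i : Fin ℓ, (i : ℕ) = 0 ∨ (i : ℕ) = ℓ - 1 → u • e i = e i := fun i h => by
    rw [hu', if_neg (by omega), one_smul]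
  rw [omega, mul_inv_rev, mul_smul, longestElement_eq_inv b Set.sdiff_subset hu, inv_inv]
  · by_cases hi : (i : ℕ) = 0 ∨ (i : ℕ) = ℓ - 1
    · rw [hpos i hi, if_pos hi, longestElement_inv_smul hℓ hD he hev, neg_one_zsmul]
    · rw [not_or] at hi
      rw [hneg i hi.1 hi.2, if_neg (by omega), smul_neg, longestElement_inv_smul hℓ hD he hev,
        neg_neg, one_smul]
  · rintro r hr
    obtain ⟨k, hk⟩ := α.surjective ⟨r, hr.1⟩
    have hr' : r = α k := by rw [hk]
    subst hr'
    have hk0 : (k : ℕ) ≠ 0 := fun h => coe_mem_diff_iff.1 hr (Fin.ext (h.trans hj.symm))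
    let p : Fin ℓ := ⟨ℓ - 2, by omega⟩
    let p' : Fin ℓ := ⟨ℓ - 1, by omega⟩
    have hp : u • e p = -e p := hneg p (by simp only [p]; omega) (by simp only [p]; omega)
    have hp' : u • e p' = e p' := hpos p' (Or.inr rfl)
    have hpr : P.root (α p) = e p - e p' := he.chain p p' (by simp only [p, p']; omega)
    have hpr' : P.root (α p') = e p + e p' :=
      he.last p p' (by simp only [p]; omega) (by simp only [p']; omega)
    -- Since u negates `e p` but fixes `e p'`, it exchanges the two fork roots up to sign; the other
    -- simple roots of the subgroup are simply negated.
    by_cases h1 : k = p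
    · subst h1
      refine ⟨α p', coe_mem_diff_iff.2 (by rw [Ne, Fin.ext_iff]; simp only [p']; omega), ?_⟩
      rw [hpr, hpr', smul_sub, hp, hp']; abel
    · by_cases h2 : k = p'
      · subst h2
        refine ⟨α p, coe_mem_diff_iff.2 (by rw [Ne, Fin.ext_iff]; simp only [p]; omega), ?_⟩
        rw [hpr, hpr', smul_add, hp, hp']; abel
      · refine ⟨α k, hr, ?_⟩
        have hkl : (k : ℕ) + 2 < ℓ := by
          simp only [p, p', Fin.ext_iff] at h1 h2; omega
        have hkr : P.root (α k) = e k - e ⟨k + 1, by omega⟩ := he.chain k _ rfl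
        rw [hkr, smul_sub, hneg k hk0 (by omega), hneg ⟨k + 1, by omega⟩ (by simp)
          (by simp only; omega)]
        abel

include hℓ hD he in
-- Without the last simple root the subgroup is of type A and permutes the frame; its longest
-- element is the reversal, which is then composed with -1.
theorem omega_last_inv_smul (hev : Even ℓ) {j : Fin ℓ} (hj : (j : ℕ) + 1 = ℓ) (i : Fin ℓ) :
    (omega b (α j : ι))⁻¹ • e i = (-1 : ℤ) • e i.rev := by
  obtain ⟨u, hu, hu'⟩ := exists_perm_smul hℓ hD he
    (H := Subgroup.closure (simpleReflections P ((b.support : Set ι) \ {(α j : ι)})))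
    (fun k hk => simpleRefl_mem_closure (coe_mem_diff_iff.2 fun h => by
      rw [h] at hk; omega)) Fin.revPerm
  simp only [Fin.revPerm_apply] at hu'
  rw [omega, mul_inv_rev, mul_smul, longestElement_eq_inv b Set.sdiff_subset hu, inv_inv, hu',
    longestElement_inv_smul hℓ hD he hev, neg_one_zsmul]
  rintro r hr
  obtain ⟨k, hk⟩ := α.surjective ⟨r, hr.1⟩
  have hr' : r = α k := by rw [hk]
  subst hr'
  have hkj := coe_mem_diff_iff.1 hr
  have hkl : (k : ℕ) + 1 < ℓ := by rw [Ne, Fin.ext_iff] at hkj; omega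
  let k' : Fin ℓ := ⟨k + 1, hkl⟩
  refine ⟨α k'.rev, coe_mem_diff_iff.2 ?_, ?_⟩
  · rw [Ne, Fin.ext_iff, Fin.val_rev]; simp only [k']; omega
  · have h1 : P.root (α k) = e k - e k' := he.chain k k' rfl
    have h2 : P.root (α k'.rev) = e k'.rev - e k.rev :=
      he.chain _ _ (by rw [Fin.val_rev, Fin.val_rev]; simp only [k']; omega)
    rw [h1, h2, smul_sub, hu', hu']; abel

end Omega

end TypeD

section Bridge

variable {ι M N : Type*} [AddCommGroup M] [Module ℝ M] [AddCommGroup N] [Module ℝ N]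
  {P : RootPairing ι ℝ M N} [P.IsCrystallographic] {b : P.Base} {ℓ : ℕ}
  {α : Fin ℓ ≃ b.support} (hℓ : 4 ≤ ℓ) (hD : IsLabellingD b ℓ α) {e : Fin ℓ → M}
  (he : IsFrameD (simpleRoot α) e)

/-! ### The coweight lattice in orthogonal coordinates -/

section Coordinates

variable [Finite ι] [P.IsRootSystem] [P.IsReduced]

include hℓ he in
omit [P.IsCrystallographic] [Finite ι] [P.IsReduced] in
theorem exists_frame_eq (v : Fin ℓ → ℝ) : ∃ x : N, ∀ i, P.toLinearMap (e i) x = v i := by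
  -- The values that the simple roots must take; as these form a basis, they determine x.
  let c : Fin ℓ → ℝ := fun k => if h : (k : ℕ) + 1 < ℓ then v k - v ⟨k + 1, h⟩
    else v ⟨ℓ - 2, by omega⟩ + v k
  obtain ⟨x, hx⟩ := (LinearMap.IsPerfPair.bijective_right P.toLinearMap).2
    (b.toWeightBasis.constr ℝ fun s => c (α.symm s))
  have hxβ : ∀ k, P.toLinearMap (simpleRoot α k) x = c k := fun k => by
    have h := LinearMap.congr_fun hx (P.root (α k))
    rw [← b.toWeightBasis_apply, Module.Basis.constr_basis] at h
    rw [simpleRoot]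
    simpa using h
  refine ⟨x, fun i => sub_eq_zero.1
    (eq_zero_of_chain hℓ (fun i => P.toLinearMap (e i) x - v i) ?_ ?_ i)⟩
  · intro i j hij
    have h := hxβ i
    rw [he.chain i j hij, map_sub, LinearMap.sub_apply] at h
    simp only [c] at h
    rw [dif_pos (by omega)] at h
    rw [sub_sub_sub_comm, h, show (⟨i + 1, by omega⟩ : Fin ℓ) = j from Fin.ext hij]
    ring
  · intro i j hi hj
    have h := hxβ j
    rw [he.last i j hi hj, map_add, LinearMap.add_apply] at h
    simp only [c] at h
    rw [dif_neg (by omega), show (⟨ℓ - 2, by omega⟩ : Fin ℓ) = i from Fin.ext (by simp; omega)] at h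
    rw [← add_sub_add_comm, h]
    ring

include hℓ he in
omit [P.IsCrystallographic] [Finite ι] [P.IsReduced] in
theorem eq_of_frame_eq {x x' : N} (h : ∀ i, P.toLinearMap (e i) x = P.toLinearMap (e i) x') :
    x = x' := by
  refine (LinearMap.IsPerfPair.bijective_right P.toLinearMap).1 (b.toWeightBasis.ext fun s => ?_)
  obtain ⟨k, rfl⟩ := α.surjective s
  rw [b.toWeightBasis_apply]
  change P.toLinearMap (simpleRoot α k) x = P.toLinearMap (simpleRoot α k) x'
  by_cases hkl : (k : ℕ) + 1 < ℓ
  · rw [he.chain k ⟨k + 1, hkl⟩ rfl]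
    simp only [map_sub, LinearMap.sub_apply, h]
  · rw [he.last ⟨ℓ - 2, by omega⟩ k (by simp only; omega) (by omega)]
    simp only [map_add, LinearMap.add_apply, h]

/-- The orthogonal coordinates of an element of the coweight lattice, multiplied by `2`. -/
def coords (e : Fin ℓ → M) (x : coweightLattice P) (i : Fin ℓ) : ℤ :=
  ⌊2 * P.toLinearMap (e i) (x : N)⌋

include hℓ hD he in
omit [Finite ι] [P.IsRootSystem] [P.IsReduced] in
-- Twice `e i` is the sum of the roots `e i - e j` and `e i + e j`, so its value is an integer and
-- the floor loses nothing.
theorem coords_eq (x : coweightLattice P) (i : Fin ℓ) :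
    (coords e x i : ℝ) = 2 * P.toLinearMap (e i) (x : N) := by
  obtain ⟨j, hij⟩ : ∃ j : Fin ℓ, i ≠ j := by
    have : Nontrivial (Fin ℓ) := Fin.nontrivial_iff_two_le.2 (by omega)
    exact (exists_ne i).imp fun _ h => h.symm
  obtain ⟨r, hr⟩ := exists_root_eq_sub hℓ hD he hij
  obtain ⟨r', hr'⟩ := exists_root_eq_add hℓ hD he hij
  obtain ⟨m, hm⟩ := x.2 r
  obtain ⟨m', hm'⟩ := x.2 r'
  rw [RootPairing.root', hr] at hm
  rw [RootPairing.root', hr'] at hm'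
  simp only [map_sub, map_add, LinearMap.sub_apply, LinearMap.add_apply] at hm hm'
  have : 2 * P.toLinearMap (e i) (x : N) = ((m + m' : ℤ) : ℝ) := by
    push_cast; linarith
  rw [coords, this, Int.floor_intCast]

include hℓ hD he in
omit [Finite ι] [P.IsRootSystem] [P.IsReduced] in
theorem coords_even_sub (x : coweightLattice P) (i j : Fin ℓ) :
    (2 : ℤ) ∣ coords e x i - coords e x j := by
  by_cases hij : i = j
  · simp [hij]
  obtain ⟨r, hr⟩ := exists_root_eq_sub hℓ hD he hij
  obtain ⟨m, hm⟩ := x.2 r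
  rw [RootPairing.root', hr] at hm
  simp only [map_sub, LinearMap.sub_apply] at hm
  refine ⟨m, ?_⟩
  have h1 := coords_eq hℓ hD he x i
  have h2 := coords_eq hℓ hD he x j
  have : ((coords e x i - coords e x j : ℤ) : ℝ) = ((2 * m : ℤ) : ℝ) := by
    push_cast; rw [h1, h2, ← hm]; ring
  exact_mod_cast this

include hℓ hD he in
theorem exists_coords_eq {v : Fin ℓ → ℤ} (hv : ∀ i j, (2 : ℤ) ∣ v i - v j) :
    ∃ x : coweightLattice P, coords e x = v := by
  obtain ⟨x, hx⟩ := exists_frame_eq hℓ he fun i => (v i : ℝ) / 2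
  have hmem : x ∈ coweightLattice P := by
    intro r
    obtain ⟨i, j, -, s, t, hs, ht, hr⟩ := exists_root_eq hℓ hD he r
    rw [RootPairing.root', hr]
    simp only [map_add, map_zsmul, LinearMap.add_apply, LinearMap.smul_apply, hx]
    obtain ⟨c, hc⟩ : (2 : ℤ) ∣ s * v i + t * v j := by
      have := hv i j
      rcases hs with rfl | rfl <;> rcases ht with rfl | rfl <;> omega
    refine ⟨c, ?_⟩
    have : ((s * v i + t * v j : ℤ) : ℝ) = ((2 * c : ℤ) : ℝ) := by rw [hc]
    push_cast at this
    rw [zsmul_eq_mul, zsmul_eq_mul]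
    linarith
  refine ⟨⟨x, hmem⟩, funext fun i => ?_⟩
  have := coords_eq hℓ hD he ⟨x, hmem⟩ i
  rw [hx i] at this
  have h2 : (coords e ⟨x, hmem⟩ i : ℝ) = v i := by rw [this]; ring
  exact_mod_cast h2

include hℓ hD he in
omit [Finite ι] [P.IsReduced] in
theorem coords_injective : Function.Injective (coords (P := P) e) := by
  intro x x' h
  refine Subtype.ext (eq_of_frame_eq hℓ he fun i => ?_)
  have h1 := coords_eq hℓ hD he x i
  rw [h, coords_eq hℓ hD he x' i] at h1
  linarith

include hℓ hD he in
omit [Finite ι] [P.IsRootSystem] [P.IsReduced] in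
theorem coords_add_nsmul (x z : coweightLattice P) (q : ℕ) (i : Fin ℓ) :
    coords e (x + q • z) i = coords e x i + q * coords e z i := by
  have h1 := coords_eq hℓ hD he (x + q • z) i
  have h2 := coords_eq hℓ hD he x i
  have h3 := coords_eq hℓ hD he z i
  have : (coords e (x + q • z) i : ℝ) = ((coords e x i + q * coords e z i : ℤ) : ℝ) := by
    rw [h1]; push_cast; rw [h2, h3]
    simp only [map_add, map_nsmul, nsmul_eq_mul]; ring
  exact_mod_cast this

variable (q : ℕ)

/-- The coordinates modulo `2q`. -/
def coordsMod (e : Fin ℓ → M) (x : coweightLattice P) (i : Fin ℓ) : ZMod (2 * q) := coords e x i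

theorem intCast_mul_natCast (u : ℤ) :
    ((q * u : ℤ) : ZMod (2 * q)) = if (2 : ℤ) ∣ u then 0 else (q : ZMod (2 * q)) := by
  have h := natCast_add_self q
  split_ifs with hu
  · obtain ⟨c, rfl⟩ := hu
    push_cast
    linear_combination (c : ZMod (2 * q)) * h
  · obtain ⟨c, rfl⟩ : ∃ c, u = 2 * c + 1 := ⟨u / 2, by omega⟩
    push_cast
    linear_combination (c : ZMod (2 * q)) * h

include hℓ hD he in
/-- Two elements of the coweight lattice are congruent modulo `q` exactly if their doubled
coordinates agree modulo `2q` up to a common shift by `q`. -/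
theorem mk_eq_mk_iff (x x' : coweightLattice P) :
    (x : LatticeMod P q) = x' ↔
      coordsMod q e x' = coordsMod q e x ∨ coordsMod q e x' = fun i => coordsMod q e x i + q := by
  have i₀ : Fin ℓ := ⟨0, by omega⟩
  rw [QuotientAddGroup.eq]
  constructor
  · rintro ⟨z, hz⟩
    have hx' : x' = x + q • z := by
      rw [← sub_eq_iff_eq_add']
      rw [sub_eq_neg_add]
      exact hz.symm
    have hc : ∀ i, coordsMod q e x' i = coordsMod q e x i + ((q * coords e z i : ℤ) : ZMod _) := by
      intro i
      rw [coordsMod, hx', coords_add_nsmul hℓ hD he, Int.cast_add]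
      rfl
    -- All coordinates of z have the same parity, so q z shifts every entry by 0 or every entry by
    -- q.
    by_cases h2 : (2 : ℤ) ∣ coords e z i₀
    · left
      funext i
      have := coords_even_sub hℓ hD he z i i₀
      rw [hc, intCast_mul_natCast, if_pos (by omega), add_zero]
    · right
      funext i
      have := coords_even_sub hℓ hD he z i i₀
      rw [hc, intCast_mul_natCast, if_neg (by omega)]
  · intro h
    -- Here a records the common shift; the numbers 2c + a are the doubled coordinates of the z with
    -- x' = x + qz.
    have hdiv : ∃ a : ℤ, ∀ i, ∃ c : ℤ, coords e x' i - coords e x i = q * (2 * c + a) := by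
      rcases h with h | h
      · refine ⟨0, fun i => ?_⟩
        have h1 := congrFun h i
        simp only [coordsMod] at h1
        rw [← sub_eq_zero, ← Int.cast_sub, ZMod.intCast_zmod_eq_zero_iff_dvd] at h1
        obtain ⟨c, hc⟩ := h1
        refine ⟨c, ?_⟩
        rw [hc]; push_cast; ring
      · refine ⟨1, fun i => ?_⟩
        have h1 := congrFun h i
        simp only [coordsMod] at h1
        have h2 : ((coords e x' i - coords e x i - q : ℤ) : ZMod (2 * q)) = 0 := by
          push_cast; rw [h1]; ring
        rw [ZMod.intCast_zmod_eq_zero_iff_dvd] at h2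
        obtain ⟨c, hc⟩ := h2
        refine ⟨c, ?_⟩
        rw [sub_eq_iff_eq_add.1 hc]; push_cast; ring
    obtain ⟨a, ha⟩ := hdiv
    choose c hc using ha
    obtain ⟨z, hz⟩ := exists_coords_eq hℓ hD he (v := fun i => 2 * c i + a)
      (fun i j => ⟨c i - c j, by ring⟩)
    refine ⟨z, ?_⟩
    have : x' = x + q • z := by
      refine coords_injective hℓ hD he (funext fun i => ?_)
      rw [coords_add_nsmul hℓ hD he, hz]
      linear_combination hc i
    rw [this]
    simp

include hℓ hD he in
omit [Finite ι] [P.IsRootSystem] [P.IsReduced] in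
theorem parity_coordsMod (x : coweightLattice P) (i j : Fin ℓ) :
    parity q (coordsMod q e x i) = parity q (coordsMod q e x j) := by
  rw [coordsMod, coordsMod, map_intCast, map_intCast, ZMod.intCast_eq_intCast_iff_dvd_sub]
  exact_mod_cast coords_even_sub hℓ hD he x j i

include hℓ hD he in
omit [P.IsRootSystem] in
/-- The condition defining the complement, in coordinates modulo `2q`. -/
theorem admissible_coordsMod_iff (x : coweightLattice P) :
    Admissible q (coordsMod q e x) ↔ ∀ r, ¬ ∃ k : ℤ, P.root' r (x : N) = (q : ℝ) * k := by
  -- The coordinates are doubled, so divisibility of a root's value by q becomes vanishing modulo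
  -- 2q.
  have hval : ∀ (i j : Fin ℓ) (s t : ℤ), (∃ k : ℤ,
      P.toLinearMap (s • e i + t • e j) (x : N) = (q : ℝ) * k) ↔
      (s : ZMod (2 * q)) * coordsMod q e x i + t * coordsMod q e x j = 0 := by
    intro i j s t
    have h1 := coords_eq hℓ hD he x i
    have h2 := coords_eq hℓ hD he x j
    have h3 : (s : ZMod (2 * q)) * coordsMod q e x i + t * coordsMod q e x j =
        ((s * coords e x i + t * coords e x j : ℤ) : ZMod (2 * q)) := by
      push_cast; rfl
    rw [h3, ZMod.intCast_zmod_eq_zero_iff_dvd]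
    refine exists_congr fun k => ?_
    simp only [map_add, map_zsmul, LinearMap.add_apply, LinearMap.smul_apply, zsmul_eq_mul]
    rw [← @Int.cast_inj ℝ]
    push_cast
    rw [h1, h2]
    constructor <;> intro h <;> linarith
  constructor
  · rintro ⟨-, h⟩ r
    obtain ⟨i, j, hij, s, t, hs, ht, hr⟩ := exists_root_eq hℓ hD he r
    rw [RootPairing.root', hr, hval]
    intro h0
    refine h i j hij ?_
    rw [signSetoid_iff]
    rcases hs with rfl | rfl <;> rcases ht with rfl | rfl <;> push_cast at h0
    · right; linear_combination h0
    · left; linear_combination h0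
    · left; linear_combination -h0
    · right; linear_combination -h0
  · intro h
    refine ⟨parity_coordsMod hℓ hD he q x, fun i j hij => ?_⟩
    rintro (h0 | h0)
    · obtain ⟨r, hr⟩ := exists_root_eq_sub hℓ hD he hij
      refine h r ?_
      rw [RootPairing.root', hr, show e i - e j = (1 : ℤ) • e i + (-1 : ℤ) • e j by module, hval]
      push_cast; linear_combination h0
    · obtain ⟨r, hr⟩ := exists_root_eq_add hℓ hD he hij
      refine h r ?_
      rw [RootPairing.root', hr, show e i + e j = (1 : ℤ) • e i + (1 : ℤ) • e j by module, hval]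
      push_cast; linear_combination h0

end Coordinates

end Bridge

/-! ### Fixed points of a signed permutation as tuples modulo 2q -/

section FixedPoints

open Finset
open scoped Classical

variable {ι M N : Type*} [AddCommGroup M] [Module ℝ M] [AddCommGroup N] [Module ℝ N]
  {P : RootPairing ι ℝ M N} [P.IsCrystallographic] {b : P.Base} {ℓ : ℕ}
  {α : Fin ℓ ≃ b.support} (hℓ : 4 ≤ ℓ) (hD : IsLabellingD b ℓ α) {e : Fin ℓ → M}
  (he : IsFrameD (simpleRoot α) e) {q : ℕ}

theorem Admissible.add_const {y : Fin ℓ → ZMod (2 * q)} (hy : Admissible q y) {c : ZMod (2 * q)}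
    (hc : 2 * c = 0) : Admissible q fun i => y i + c := by
  refine ⟨fun i j => by rw [map_add, map_add, hy.1 i j], fun i j hij => ?_⟩
  rintro (h | h)
  · exact hy.2 i j hij (Or.inl (by linear_combination h))
  · exact hy.2 i j hij (Or.inr (by linear_combination h - hc))

include hℓ hD he in
theorem coordsMod_smul {w : P.weylGroup} {σ : Fin ℓ → Fin ℓ} {ε : Fin ℓ → ℤ}
    (hw : ∀ i, w⁻¹ • e i = ε i • e (σ i)) (x : coweightLattice P) (i : Fin ℓ) :
    coordsMod q e (w • x) i = ε i * coordsMod q e x (σ i) := by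
  have h1 := coords_eq hℓ hD he (w • x) i
  have h2 : P.toLinearMap (e i) ((w • x : coweightLattice P) : N) =
      P.toLinearMap (w⁻¹ • e i) (x : N) := pairing_coweightAct P w (e i) x
  rw [h2, hw, map_zsmul, LinearMap.smul_apply, zsmul_eq_mul] at h1
  have h3 : coords e (w • x) i = ε i * coords e x (σ i) := by
    have : (coords e (w • x) i : ℝ) = ((ε i * coords e x (σ i) : ℤ) : ℝ) := by
      rw [h1]; push_cast; rw [coords_eq hℓ hD he]; ring
    exact_mod_cast this
  rw [coordsMod, h3, Int.cast_mul]
  rfl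

include hℓ hD he in
/-- The permutation character as a number of tuples of residues modulo `2q`. -/
theorem two_mul_equivChar [Finite ι] [P.IsRootSystem] [P.IsReduced] [Fintype (ZMod (2 * q))]
    (hq : 0 < q) {w : P.weylGroup} {σ : Fin ℓ → Fin ℓ} {ε : Fin ℓ → ℤ}
    (hε : ∀ i, ε i = 1 ∨ ε i = -1) (hw : ∀ i, w⁻¹ • e i = ε i • e (σ i)) :
    2 * equivChar P q w = #{y : Fin ℓ → ZMod (2 * q) | Admissible q y ∧
      ((fun i => ε i * y (σ i)) = y ∨ (fun i => ε i * y (σ i)) = fun i => y i + q)} := by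
  have hqq := natCast_add_self q
  have hq0 := natCast_ne_zero hq
  have i₀ : Fin ℓ := ⟨0, by omega⟩
  -- Signs do not affect 2-torsion, so the translation by q commutes with the action.
  have hεc : ∀ (i : Fin ℓ) (c : ZMod (2 * q)), 2 * c = 0 → (ε i : ZMod (2 * q)) * c = c := by
    intro i c hc
    rcases hε i with h | h <;> rw [h] <;> push_cast
    · ring
    · linear_combination -hc
  have hmk : ∀ x : coweightLattice P, modAct P q w (x : LatticeMod P q) = x ↔
      ((fun i => ε i * coordsMod q e x (σ i)) = coordsMod q e x ∨
        (fun i => ε i * coordsMod q e x (σ i)) = fun i => coordsMod q e x i + q) := by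
    intro x
    have h1 : modAct P q w (x : LatticeMod P q) = ((w • x : coweightLattice P) : LatticeMod P q) :=
      rfl
    rw [h1, eq_comm, mk_eq_mk_iff hℓ hD he,
      funext (coordsMod_smul (q := q) hℓ hD he hw x)]
  choose ρ hρ hρ' using fun t : complement P q => t.2
  let shift : Bool → ZMod (2 * q) := fun s => if s then q else 0
  have hshift : ∀ s, 2 * shift s = 0 := by
    rintro (_ | _)
    · simp [shift]
    · simp only [shift, if_true]; linear_combination hqq
  have hmem : ∀ p : MulAction.fixedBy (complement P q) w × Bool,
      Admissible q (fun i => coordsMod q e (ρ p.1) i + shift p.2) ∧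
      ((fun i => ε i * (coordsMod q e (ρ p.1) (σ i) + shift p.2)) =
          (fun i => coordsMod q e (ρ p.1) i + shift p.2) ∨
        (fun i => ε i * (coordsMod q e (ρ p.1) (σ i) + shift p.2)) =
          fun i => coordsMod q e (ρ p.1) i + shift p.2 + q) := by
    rintro ⟨⟨t, ht⟩, s⟩
    refine ⟨((admissible_coordsMod_iff hℓ hD he q _).2 (hρ' t)).add_const (hshift s), ?_⟩
    have ht' : modAct P q w (t : LatticeMod P q) = t := congrArg Subtype.val ht
    rw [← hρ t, hmk] at ht'
    refine ht'.imp (fun h => funext fun i => ?_) (fun h => funext fun i => ?_)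
    · have := congrFun h i
      simp only at this ⊢
      linear_combination this + hεc i _ (hshift s)
    · have := congrFun h i
      simp only at this ⊢
      linear_combination this + hεc i _ (hshift s)
  -- A fixed class together with a Boolean goes to one of its two lifts, that of the chosen
  -- representative or its translate by q. They differ because q is not 0 modulo 2q.
  let F : MulAction.fixedBy (complement P q) w × Bool → {y : Fin ℓ → ZMod (2 * q) //
      Admissible q y ∧ ((fun i => ε i * y (σ i)) = y ∨
        (fun i => ε i * y (σ i)) = fun i => y i + q)} :=
    fun p => ⟨fun i => coordsMod q e (ρ p.1) i + shift p.2, hmem p⟩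
  have hF : Function.Bijective F := by
    constructor
    · rintro ⟨⟨t, ht⟩, s⟩ ⟨⟨t', ht'⟩, s'⟩ h
      have h1 : ∀ i, coordsMod q e (ρ t) i + shift s = coordsMod q e (ρ t') i + shift s' :=
        fun i => congrFun (congrArg Subtype.val h) i
      have htt : t = t' := by
        apply Subtype.ext
        rw [← hρ t, ← hρ t', mk_eq_mk_iff hℓ hD he]
        rcases s with _ | _ <;> rcases s' with _ | _ <;>
          simp only [shift, if_true, Bool.false_eq_true, if_false, add_zero] at h1
        · exact Or.inl (funext fun i => (h1 i).symm)
        · exact Or.inr (funext fun i => by linear_combination -h1 i - hqq)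
        · exact Or.inr (funext fun i => (h1 i).symm)
        · exact Or.inl (funext fun i => by linear_combination -h1 i)
      subst htt
      have h2 : shift s = shift s' := by linear_combination h1 i₀
      have h3 : s = s' := by
        rcases s with _ | _ <;> rcases s' with _ | _ <;>
          simp only [shift, if_true, Bool.false_eq_true, if_false] at h2
        · rfl
        · exact absurd h2.symm hq0
        · exact absurd h2 hq0
        · rfl
      rw [h3]
    · rintro ⟨y, hy, hfix⟩
      have : NeZero (2 * q) := ⟨by omega⟩
      choose v hv using fun i => ZMod.intCast_surjective (y i)
      have hpar : ∀ i j, (2 : ℤ) ∣ v i - v j := by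
        intro i j
        have h := hy.1 j i
        rw [← hv i, ← hv j, map_intCast, map_intCast, ZMod.intCast_eq_intCast_iff_dvd_sub] at h
        exact_mod_cast h
      obtain ⟨x, hx⟩ := exists_coords_eq hℓ hD he hpar
      have hxy : coordsMod q e x = y := funext fun i => by rw [coordsMod, hx, hv]
      have hcomp : (x : LatticeMod P q) ∈ complement P q :=
        ⟨x, rfl, (admissible_coordsMod_iff hℓ hD he q x).1 (hxy ▸ hy)⟩
      let t : complement P q := ⟨x, hcomp⟩
      have ht : t ∈ MulAction.fixedBy (complement P q) w := by
        refine Subtype.ext ?_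
        change modAct P q w (x : LatticeMod P q) = x
        rw [hmk, hxy]
        exact hfix
      have hrep := hρ t
      change (ρ t : LatticeMod P q) = x at hrep
      rw [mk_eq_mk_iff hℓ hD he, hxy] at hrep
      rcases hrep with h | h
      · refine ⟨⟨⟨t, ht⟩, false⟩, Subtype.ext (funext fun i => ?_)⟩
        simp [F, shift, h]
      · refine ⟨⟨⟨t, ht⟩, true⟩, Subtype.ext (funext fun i => ?_)⟩
        simp [F, shift, h]
  have hcard := Nat.card_congr (Equiv.ofBijective F hF)
  rw [Nat.card_prod, Nat.card_eq_fintype_card (α := Bool), Fintype.card_bool,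
    Nat.card_eq_fintype_card (α := {y : Fin ℓ → ZMod (2 * q) // _}), Fintype.card_subtype] at hcard
  rw [equivChar, permCharacter, mul_comm]
  exact hcard

/-! ### Relabelling -/

theorem prod_Icc_one_eq (f : ℕ → ℚ) (m : ℕ) :
    ∏ k ∈ Finset.Icc 1 m, f k = ∏ k ∈ Finset.range m, f (k + 1) := by
  rw [Finset.range_eq_Ico, Finset.prod_Ico_add' f 0 m 1]
  rfl

/-- A form of the Cartan matrix in which the last two indices visibly play the same role. -/
theorem D_apply (hℓ : 4 ≤ ℓ) (i j : Fin ℓ) : CartanMatrix.D ℓ i j =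
    if (i : ℕ) = j then 2 else
      if ((i : ℕ) + 1 = j ∧ (j : ℕ) + 2 < ℓ) ∨ ((j : ℕ) + 1 = i ∧ (i : ℕ) + 2 < ℓ) ∨
        ((i : ℕ) + 3 = ℓ ∧ ℓ ≤ (j : ℕ) + 2) ∨ ((j : ℕ) + 3 = ℓ ∧ ℓ ≤ (i : ℕ) + 2) then -1 else 0 := by
  simp only [CartanMatrix.D, Matrix.of_apply, Fin.ext_iff]
  have := i.2; have := j.2
  split_ifs <;> first | rfl | omega

theorem D_swap_last (hℓ : 4 ≤ ℓ) {k k' : Fin ℓ} (hk : (k : ℕ) + 2 = ℓ) (hk' : (k' : ℕ) + 1 = ℓ)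
    (i j : Fin ℓ) :
    CartanMatrix.D ℓ (Equiv.swap k k' i) (Equiv.swap k k' j) = CartanMatrix.D ℓ i j := by
  have key : ∀ i : Fin ℓ, ((i : ℕ) + 2 < ℓ ∧ ((Equiv.swap k k' i : Fin ℓ) : ℕ) = i) ∨
      ((i : ℕ) + 2 = ℓ ∧ ((Equiv.swap k k' i : Fin ℓ) : ℕ) + 1 = ℓ) ∨
      ((i : ℕ) + 1 = ℓ ∧ ((Equiv.swap k k' i : Fin ℓ) : ℕ) + 2 = ℓ) := by
    intro i
    rw [val_swap]
    have := i.2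
    split_ifs <;> omega
  have hi := key i
  have hj := key j
  rw [D_apply hℓ, D_apply hℓ]
  exact if_congr (by omega) rfl (if_congr (by omega) rfl rfl)

theorem IsLabellingD.swap_last (hℓ : 4 ≤ ℓ) (hD : IsLabellingD b ℓ α) {k k' : Fin ℓ}
    (hk : (k : ℕ) + 2 = ℓ) (hk' : (k' : ℕ) + 1 = ℓ) :
    IsLabellingD b ℓ ((Equiv.swap k k').trans α) := fun i j => by
  rw [Equiv.trans_apply, Equiv.trans_apply, hD, D_swap_last hℓ hk hk']

/-! ### The values of the character -/

section Values

variable [Finite ι] [P.IsRootSystem] [P.IsReduced]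

include hℓ hD in
theorem two_mul_equivChar_one [Fintype (ZMod (2 * q))] (hq : 0 < q) :
    2 * equivChar P q 1 = #{y : Fin ℓ → ZMod (2 * q) | Admissible q y} := by
  obtain ⟨e, he⟩ := exists_isFrameD hℓ (simpleRoot α)
  rw [two_mul_equivChar hℓ hD he hq (σ := id) (ε := 1) (fun _ => Or.inl rfl) (by simp)]
  simp

include hℓ hD in
theorem two_mul_equivChar_omega_first [Fintype (ZMod (2 * q))] (hq : 0 < q) (hev : Even ℓ)
    {j : Fin ℓ} (hj : (j : ℕ) = 0) :
    2 * equivChar P q (omega b (α j : ι)) =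
      #{y : Fin ℓ → ZMod (2 * q) | Admissible q y ∧
        (negEnds y = y ∨ negEnds y = fun i => y i + q)} := by
  obtain ⟨e, he⟩ := exists_isFrameD hℓ (simpleRoot α)
  rw [two_mul_equivChar hℓ hD he hq (σ := id) (fun i => by split_ifs <;> simp)
    (omega_first_inv_smul hℓ hD he hev hj)]
  have h : ∀ y : Fin ℓ → ZMod (2 * q), (fun i : Fin ℓ =>
      (((if (i : ℕ) = 0 ∨ (i : ℕ) = ℓ - 1 then (-1 : ℤ) else 1 : ℤ)) : ZMod (2 * q)) * y (id i)) =
      negEnds y := by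
    intro y
    funext i
    simp only [negEnds, id]
    split_ifs <;> simp
  simp only [h]

include hℓ hD in
theorem two_mul_equivChar_omega_last [Fintype (ZMod (2 * q))] (hq : 0 < q) (hev : Even ℓ)
    {j : Fin ℓ} (hj : (j : ℕ) + 1 = ℓ) :
    2 * equivChar P q (omega b (α j : ι)) =
      #{y : Fin ℓ → ZMod (2 * q) | Admissible q y ∧
        (negRev y = y ∨ negRev y = fun i => y i + q)} := by
  obtain ⟨e, he⟩ := exists_isFrameD hℓ (simpleRoot α)
  rw [two_mul_equivChar hℓ hD he hq (σ := Fin.rev) (ε := fun _ => -1) (fun _ => Or.inr rfl)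
    (omega_last_inv_smul hℓ hD he hev hj)]
  have h : ∀ y : Fin ℓ → ZMod (2 * q), (fun i : Fin ℓ =>
      ((-1 : ℤ) : ZMod (2 * q)) * y i.rev) = negRev y := by
    intro y
    funext i
    simp [negRev]
  simp only [h]

include hℓ hD in
theorem equivChar_one_of_odd (hq : 0 < q) (h : ¬ 2 ∣ q) : (equivChar P q 1 : ℚ) =
    (∏ k ∈ Finset.Icc 1 (ℓ - 1), ((q : ℚ) - (2 * k - 1))) * (q - (ℓ - 1)) := by
  have : NeZero (2 * q) := ⟨by omega⟩
  have h1 := two_mul_equivChar_one hℓ hD hq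
  obtain ⟨n, rfl⟩ : ∃ n, ℓ = n + 1 := ⟨ℓ - 1, by omega⟩
  have h2 := card_admissible_of_odd q hq h n
  rw [← h1] at h2
  push_cast at h2
  rw [mul_left_cancel₀ two_ne_zero h2, prod_Icc_one_eq, Nat.add_sub_cancel]
  push_cast
  congr 1
  · exact prod_congr rfl fun k _ => by ring
  · ring

include hℓ hD in
theorem equivChar_one_of_even (hq : 0 < q) (h : 2 ∣ q) : (equivChar P q 1 : ℚ) =
    (∏ k ∈ Finset.Icc 1 (ℓ - 2), ((q : ℚ) - 2 * k)) *
      ((q : ℚ) ^ 2 - 2 * (ℓ - 1) * q + ℓ * (ℓ - 1) / 2) := by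
  have : NeZero (2 * q) := ⟨by omega⟩
  have h1 := two_mul_equivChar_one hℓ hD hq
  obtain ⟨n, rfl⟩ : ∃ n, ℓ = n + 2 := ⟨ℓ - 2, by omega⟩
  have h2 := card_admissible_of_even q hq h n
  rw [← h1] at h2
  push_cast at h2
  rw [mul_left_cancel₀ two_ne_zero h2, prod_Icc_one_eq, Nat.add_sub_cancel]
  push_cast
  ring

include hℓ hD in
theorem equivChar_omega_first_of_odd (hev : Even ℓ) (hq : 0 < q) (h : ¬ 2 ∣ q)
    {j : Fin ℓ} (hj : (j : ℕ) = 0) :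
    equivChar P q (omega b (α j : ι)) = 0 := by
  have : NeZero (2 * q) := ⟨by omega⟩
  have h1 := two_mul_equivChar_omega_first hℓ hD hq hev hj
  obtain ⟨n, rfl⟩ : ∃ n, ℓ = n + 2 := ⟨ℓ - 2, by omega⟩
  rw [card_admissible_negEnds_of_odd q hq h (by omega)] at h1
  omega

include hℓ hD in
theorem equivChar_omega_first_of_even (hev : Even ℓ) (hq : 0 < q) (h : 2 ∣ q)
    {j : Fin ℓ} (hj : (j : ℕ) = 0) :
    (equivChar P q (omega b (α j : ι)) : ℚ) =
      ∏ k ∈ Finset.Icc 1 (ℓ - 2), ((q : ℚ) - 2 * k) := by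
  have : NeZero (2 * q) := ⟨by omega⟩
  have h1 := two_mul_equivChar_omega_first hℓ hD hq hev hj
  obtain ⟨n, rfl⟩ : ∃ n, ℓ = n + 2 := ⟨ℓ - 2, by omega⟩
  have h2 := card_admissible_negEnds_of_even q hq h (n := n) (by omega)
  rw [← h1] at h2
  push_cast at h2
  rw [mul_left_cancel₀ two_ne_zero h2, prod_Icc_one_eq, Nat.add_sub_cancel]
  push_cast
  rfl

include hℓ hD in
theorem equivChar_omega_last (hev : Even ℓ) (hq : 0 < q) {j : Fin ℓ} (hj : (j : ℕ) + 1 = ℓ) :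
    (Nat.gcd 4 q = 1 → (equivChar P q (omega b (α j : ι)) : ℚ) = 0) ∧
    (Nat.gcd 4 q = 2 → (equivChar P q (omega b (α j : ι)) : ℚ) =
      (∏ k ∈ Finset.Icc 1 (ℓ / 2 - 1), ((q : ℚ) - (4 * k - 2))) * (q - (3 * (ℓ : ℚ) / 2 - 2))) ∧
    (Nat.gcd 4 q = 4 → (equivChar P q (omega b (α j : ι)) : ℚ) =
      (∏ k ∈ Finset.Icc 1 (ℓ / 2 - 1), ((q : ℚ) - 4 * k)) * (q - (ℓ : ℚ) / 2)) := by
  have : NeZero (2 * q) := ⟨by omega⟩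
  have h1 := two_mul_equivChar_omega_last hℓ hD hq hev hj
  obtain ⟨n, rfl⟩ : ∃ n, ℓ = 2 * (n + 1) := by
    obtain ⟨m, hm⟩ := hev
    exact ⟨m - 1, by omega⟩
  rw [prod_Icc_one_eq, prod_Icc_one_eq, show 2 * (n + 1) / 2 - 1 = n by omega]
  refine ⟨fun hg => ?_, fun hg => ?_, fun hg => ?_⟩
  · have h2 : ¬ 2 ∣ q := fun h => by
      have := Nat.dvd_gcd (by norm_num : 2 ∣ 4) h
      rw [hg] at this; omega
    rw [card_admissible_negRev_of_odd q h2 (by omega)] at h1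
    have : equivChar P q (omega b (α j : ι)) = 0 := by omega
    rw [this, Nat.cast_zero]
  · have h2 : 2 ∣ q := hg ▸ Nat.gcd_dvd_right 4 q
    rw [card_admissible_negRev_of_even q hq h2 (by omega)] at h1
    have h3 := sepCount_klein_sum_of_gcd_eq_two q hq hg n
    rw [← Nat.cast_add, ← h1] at h3
    push_cast at h3
    rw [mul_left_cancel₀ two_ne_zero h3]
    push_cast
    congr 1
    · exact prod_congr rfl fun k _ => by ring
    · ring
  · have h2 : 2 ∣ q := (by norm_num : 2 ∣ 4).trans (hg ▸ Nat.gcd_dvd_right 4 q)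
    rw [card_admissible_negRev_of_even q hq h2 (by omega)] at h1
    have h3 := sepCount_klein_sum_of_gcd_eq_four q hq hg n
    rw [← Nat.cast_add, ← h1] at h3
    push_cast at h3
    rw [mul_left_cancel₀ two_ne_zero h3]
    push_cast
    ring

end Values

end FixedPoints

end WeylChar

end

theorem mainTheorem9 {ι M N : Type*} [Finite ι] [AddCommGroup M] [Module ℝ M]
    [AddCommGroup N] [Module ℝ N]
    (P : RootPairing ι ℝ M N) [P.IsRootSystem] [P.IsCrystallographic] [P.IsReduced]
    (b : P.Base) (ℓ : ℕ) (hℓ : 4 ≤ ℓ) (hev : Even ℓ)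
    (α : Fin ℓ ≃ b.support) (hD : WeylChar.IsLabellingD b ℓ α)
    (q : ℕ) (hq : 0 < q) :
    -- `ω = 1`
    (¬ 2 ∣ q → (WeylChar.equivChar P q 1 : ℚ) =
      (∏ k ∈ Finset.Icc 1 (ℓ - 1), ((q : ℚ) - (2 * k - 1))) * (q - (ℓ - 1))) ∧
    (2 ∣ q → (WeylChar.equivChar P q 1 : ℚ) =
      (∏ k ∈ Finset.Icc 1 (ℓ - 2), ((q : ℚ) - 2 * k)) *
        ((q : ℚ) ^ 2 - 2 * (ℓ - 1) * q + ℓ * (ℓ - 1) / 2)) ∧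
    -- `ω = ω_1`
    (¬ 2 ∣ q → (WeylChar.equivChar P q (WeylChar.omega b (α ⟨0, by omega⟩)) : ℚ) = 0) ∧
    (2 ∣ q → (WeylChar.equivChar P q (WeylChar.omega b (α ⟨0, by omega⟩)) : ℚ) =
      ∏ k ∈ Finset.Icc 1 (ℓ - 2), ((q : ℚ) - 2 * k)) ∧
    -- `ω = ω_{ℓ-1}` (first index below) and `ω = ω_ℓ` (second index below)
    (∀ j : Fin ℓ, (j : ℕ) = ℓ - 2 ∨ (j : ℕ) = ℓ - 1 →
      (Nat.gcd 4 q = 1 → (WeylChar.equivChar P q (WeylChar.omega b (α j)) : ℚ) = 0) ∧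
      (Nat.gcd 4 q = 2 → (WeylChar.equivChar P q (WeylChar.omega b (α j)) : ℚ) =
        (∏ k ∈ Finset.Icc 1 (ℓ / 2 - 1), ((q : ℚ) - (4 * k - 2))) *
          (q - (3 * (ℓ : ℚ) / 2 - 2))) ∧
      (Nat.gcd 4 q = 4 → (WeylChar.equivChar P q (WeylChar.omega b (α j)) : ℚ) =
        (∏ k ∈ Finset.Icc 1 (ℓ / 2 - 1), ((q : ℚ) - 4 * k)) *
          (q - (ℓ : ℚ) / 2))) := by
  refine ⟨WeylChar.equivChar_one_of_odd hℓ hD hq, WeylChar.equivChar_one_of_even hℓ hD hq,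
    fun h => ?_, fun h => WeylChar.equivChar_omega_first_of_even hℓ hD hev hq h rfl, fun j hj => ?_⟩
  · rw [WeylChar.equivChar_omega_first_of_odd hℓ hD hev hq h rfl, Nat.cast_zero]
  · by_cases hj' : (j : ℕ) + 1 = ℓ
    · exact WeylChar.equivChar_omega_last hℓ hD hev hq hj'
    · have hk : (j : ℕ) + 2 = ℓ := by omega
      have hlast : ((⟨ℓ - 1, by omega⟩ : Fin ℓ) : ℕ) + 1 = ℓ := by simp only; omega
      -- Exchanging the labels of the two fork ends is a diagram automorphism, so the second last
      -- simple root becomes the last one of another valid labelling.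
      have h := WeylChar.equivChar_omega_last hℓ (hD.swap_last hℓ hk hlast) hev hq hlast
      rwa [Equiv.trans_apply, Equiv.swap_apply_right] at h
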